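/- **Setting.** Let $\mathcal C$ be a cartesian closed category with finite limits (for example a topos), $k$ a commutative ring, and $R$ a commutative $k$-algebra object of $\mathcal C$. A Weil algebra over $k$ is a commutative $k$-algebra of the form $W=k\oplus I$ with $I$ a nilpotent ideal that is free of finite rank over $k$; $\mathrm{Spec}_R W$ denotes the object of $k$-algebra homomorphisms $W\to R$, and the objects isomorphic to some $\mathrm{Spec}_RW$ are called small. Assume the general Kock–Lawvere axiom: for every Weil algebra $W$ the canonical map $R\otimes_k W\to R^{\mathrm{Spec}_R W}$ is an isomorphism. A finite cocone of small objects is a quasi-colimit if $R^{(-)}$ turns it into a limit cone; an object $M$ is microlinear if $M^{(-)}$ turns every quasi-colimit into a limit cone. Mappings $S\to M$ are understood at an arbitrary stage $X\in\mathcal C$, i.e. as morphisms $S\times X\to M$ (for $X=1$: morphisms $S\to M$). For $n\ge 0$ and a set $\mathfrak p$ of pairs of indices let $$D^n\{\mathfrak p\}=\{(d_1,\dots,d_n)\in R^n \mid d_i^2=0 \text{ for all } i,\ d_id_j=0\text{ for all }(i,j)\in\mathfrak p\},\qquad D^n=D^n\{\emptyset\},\quad D=D^1.$$ *Strong differences.*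 For $\gamma_1,\gamma_2:D^{n+2}\to M$, if there is a unique $\mathfrak n:D^{n+3}\{(n+1,n+3),(n+2,n+3)\}\to M$ with $\mathfrak n(d_1,\dots,d_{n+2},d_{n+1}d_{n+2})=\gamma_1(d_1,\dots,d_{n+2})$ and $\mathfrak n(d_1,\dots,d_{n+2},0)=\gamma_2(d_1,\dots,d_{n+2})$, then $\gamma_1\overset{\cdot}{\underset{1\dots n}{-}}\gamma_2:D^{n+1}\to M$ is defined, as the mapping $(d_1,\dots,d_{n+1})\mapsto\mathfrak n(d_1,\dots,d_n,0,0,d_{n+1})$; for $n=0$ it is written $\gamma_1\overset{\cdot}{-}\gamma_2$. For a permutation $\sigma$ of $\{1,\dots,n+2\}$ put $\gamma^\sigma(d_1,\dots,d_{n+2})=\gamma(d_{\sigma^{-1}(1)},\dots,d_{\sigma^{-1}(n+2)})$ and $\gamma_1\overset{\cdot}{\underset{\sigma(1)\dots\sigma(n)}{-}}\gamma_2=\gamma_1^{\sigma}\overset{\cdot}{\underset{1\dots n}{-}}\gamma_2^{\sigma}$. *Sums of tangent vectors.* For $t_1,t_2:D\to M$, if there is a unique $l:D^2\{(1,2)\}\to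 M$ with $l(d,0)=t_1(d)$ and $l(0,d)=t_2(d)$, then $t_1+t_2$ is defined, as the mapping $d\mapsto l(d,d)$. The zero tangent vector at a point $x$ is the constant mapping $d\mapsto x$. **Theorem (four-dimensional general Jacobi identity).** Let $M$ be microlinear. For each of the $24$ permutations of $\{1,2,3,4\}$, written as a word $abcd$, let $\gamma_{abcd}:D^4\to M$ be a mapping. Suppose that whenever two words differ by the interchange of two neighbouring letters $p,q$, the corresponding two mappings have equal restrictions to $D^4\{(p,q)\}$ ($36$ conditions; e.g. $\gamma_{1234}|D^4\{(3,4)\}=\gamma_{1243}|D^4\{(3,4)\}$ and $\gamma_{1234}|D^4\{(2,3)\}=\gamma_{1324}|D^4\{(2,3)\}$). Then, for each of the twelve even permutations $abcd$ of $\{1,2,3,4\}$, the tangent vector $$\Bigl(\bigl(\gamma_{abcd}\overset{\cdot}{\underset{ab}{-}}\gamma_{abdc}\bigr)\overset{\cdot}{\underset{1}{-}}\bigl(\gamma_{acdb}\overset{\cdot}{\underset{ab}{-}}\gamma_{adcb}\bigr)\Bigr)\overset{\cdot}{-}\Bigl(\bigl(\gamma_{bcda}\overset{\cdot}{\underset{ab}{-}}\gamma_{bdca}\bigr)\overset{\cdot}{\underset{1}{-}}\bigl(\gamma_{cdba}\overset{\cdot}{\underset{ab}{-}}\gamma_{dcba}\bigr)\Bigr)$$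 is defined (all the strong differences in it exist; $\underset{ab}{-}$ is formed with the permutation $\sigma=abcd$, so $\sigma(1)=a$, $\sigma(2)=b$), the sum of these twelve tangent vectors, in any order, is defined, and it equals the zero tangent vector at $\gamma_{1234}(0,0,0,0)$. -/

import Mathlib

/-!
Synthetic differential geometry, interpreted in an arbitrary cartesian closed category `C` with
finite limits (for instance any topos) that contains a commutative ring object `R`, the line,
satisfying the general Kock-Lawvere axiom.  A "mapping" between spaces is interpreted at an
arbitrary stage of definition `X`: an element of `M ^ S` at stage `X` is a morphism
`S ⊗ X ⟶ M`, where `⊗` is the cartesian product of `C`.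
-/

universe w v u

open CategoryTheory MonoidalCategory CartesianMonoidalCategory Limits

open scoped CommRingObj TensorProduct

namespace SDG

variable {C : Type u} [Category.{v} C] [CartesianMonoidalCategory C] [BraidedCategory C]

/-- The structure of a `k`-algebra object on a commutative ring object `R`: each ring
`Hom(X, R)` is a `k`-algebra, naturally in `X`. -/
class AlgebraObj (k : Type w) [CommRing k] (R : C) [CommRingObj R] where
  /-- the `k`-algebra structure on the ring of elements of `R` at stage `X` -/
  algebra : ∀ X : C, Algebra k (X ⟶ R)
  comp_algebraMap : ∀ {X Y : C} (f : X ⟶ Y) (a : k),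
    f ≫ (algebra Y).algebraMap a = (algebra X).algebraMap a

instance (k : Type w) [CommRing k] (R : C) [CommRingObj R] [AlgebraObj k R] (X : C) :
    Algebra k (X ⟶ R) :=
  AlgebraObj.algebra X

/-- Change of stage `r ↦ f ≫ r`, as a homomorphism of `k`-algebras. -/
def precomp (k : Type w) [CommRing k] (R : C) [CommRingObj R] [AlgebraObj k R] {X Y : C}
    (f : X ⟶ Y) : (Y ⟶ R) →ₐ[k] (X ⟶ R) where
  toFun r := f ≫ r
  map_one' := MonObj.comp_one f
  map_mul' := MonObj.comp_mul f
  map_zero' := AddMonObj.comp_zero f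
  map_add' := AddMonObj.comp_add f
  commutes' := AlgebraObj.comp_algebraMap f

/-- A Weil algebra over `k`: a commutative `k`-algebra of the form `k ⊕ I`, where the ideal `I`
is nilpotent, and free of finite rank as a `k`-module. -/
def IsWeilAlgebra (k : Type w) [CommRing k] (W : Type w) [CommRing W] [Algebra k W] : Prop :=
  ∃ ε : W →ₐ[k] k, IsNilpotent (RingHom.ker ε) ∧
    Module.Free k (RingHom.ker ε) ∧ Module.Finite k (RingHom.ker ε)

section Small

variable (k : Type w) [CommRing k] (R : C) [CommRingObj R] [AlgebraObj k R]

/-- The object `S`, with the functions `x w : S ⟶ R` for `w ∈ W`, is the space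
`Spec_R W` of `k`-algebra homomorphisms from `W` to `R`.
If `W = k[X₁, …, Xₙ]/I`, this is the subspace of `R ^ n` on which the polynomials in `I` vanish. -/
def IsSpec {W : Type w} [CommRing W] [Algebra k W] {S : C} (x : W →ₐ[k] (S ⟶ R)) : Prop :=
  ∀ (X : C) (φ : W →ₐ[k] (X ⟶ R)), ∃! f : X ⟶ S, (precomp k R f).comp x = φ

/-- Small objects: the objects `Spec_R W`, with `W` a Weil algebra. -/
def IsSmall (S : C) : Prop :=
  ∃ (W : Type w) (_ : CommRing W) (_ : Algebra k W), IsWeilAlgebra k W ∧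
    ∃ x : W →ₐ[k] (S ⟶ R), IsSpec k R x

/-- The general Kock-Lawvere axiom: for every Weil algebra `W`, the canonical map
`R ⊗ W ⟶ R ^ (Spec_R W)` is an isomorphism, i.e. it is bijective on elements at every stage `X`. -/
def KockLawvere : Prop :=
  ∀ (W : Type w) [CommRing W] [Algebra k W], IsWeilAlgebra k W →
    ∀ (S : C) (x : W →ₐ[k] (S ⟶ R)), IsSpec k R x → ∀ X : C,
      Function.Bijective (Algebra.TensorProduct.productMap
        (precomp k R (snd S X)) ((precomp k R (fst S X)).comp x) :
          (X ⟶ R) ⊗[k] W →ₐ[k] (S ⊗ X ⟶ R))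

/-- `M` perceives the cocone `c` as a colimit: the contravariant functor `M ^ (-)` turns `c`
into a limit cone. -/
def Perceives [MonoidalClosed C] (M : C) {J : Type} [SmallCategory J] {F : J ⥤ C}
    (c : Cocone F) : Prop :=
  Nonempty (IsLimit ((MonoidalClosed.internalHom.flip.obj M).mapCone c.op))

/-- `M` is microlinear: it perceives as a colimit every finite cocone of small objects which is a
quasi-colimit, i.e. which the line `R` perceives as a colimit. -/
def Microlinear [MonoidalClosed C] (M : C) : Prop :=
  ∀ (J : Type) [SmallCategory J] [FinCategory J] (F : J ⥤ C) (c : Cocone F),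
    (∀ j, IsSmall k R (F.obj j)) → IsSmall k R c.pt → Perceives R c → Perceives M c

end Small

section Infinitesimal

variable [HasFiniteLimits C] (R : C) [CommRingObj R]

/-- The simplicial small object `D ^ n {p}`: the subobject of `R ^ n` of all `(d₁, …, dₙ)` with
`dᵢ ^ 2 = 0` for all `i` and `dᵢ dⱼ = 0` for all `(i, j) ∈ p`. -/
noncomputable def D (n : ℕ) (p : Finset (Fin n × Fin n)) : C :=
  equalizer
    (Pi.lift fun ij : Fin n × Fin n =>
      if ij.1 = ij.2 ∨ ij ∈ p then
        Pi.π (fun _ : Fin n => R) ij.1 * Pi.π (fun _ : Fin n => R) ij.2 else 0)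
    (Pi.lift fun _ : Fin n × Fin n => (0 : (∏ᶜ fun _ : Fin n => R) ⟶ R))

variable {R} {n : ℕ} {p : Finset (Fin n × Fin n)}

/-- The `i`-th coordinate on `D ^ n {p}`. -/
noncomputable def coord (i : Fin n) : D R n p ⟶ R :=
  equalizer.ι _ _ ≫ Pi.π (fun _ : Fin n => R) i

lemma coord_mul_coord {i j : Fin n} (h : i = j ∨ (i, j) ∈ p) :
    (coord i * coord j : D R n p ⟶ R) = 0 := by
  have := congrArg (· ≫ Pi.π (fun _ : Fin n × Fin n => R) (i, j)) (equalizer.condition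
    (Pi.lift fun ij : Fin n × Fin n =>
      if ij.1 = ij.2 ∨ ij ∈ p then
        Pi.π (fun _ : Fin n => R) ij.1 * Pi.π (fun _ : Fin n => R) ij.2 else 0)
    (Pi.lift fun _ : Fin n × Fin n => (0 : (∏ᶜ fun _ : Fin n => R) ⟶ R)))
  simp only [Category.assoc, limit.lift_π, Fan.mk_π_app, if_pos h, MonObj.comp_mul,
    AddMonObj.comp_zero] at this
  exact this

lemma coord_mul_self (i : Fin n) : (coord i * coord i : D R n p ⟶ R) = 0 :=
  coord_mul_coord (Or.inl rfl)

/-- The element `(a₁, …, aₙ)` of `D ^ n {p}` at stage `Y`. -/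
noncomputable def mk {Y : C} (a : Fin n → (Y ⟶ R)) (ha : ∀ i, a i * a i = 0)
    (hp : ∀ ij ∈ p, a ij.1 * a ij.2 = 0) : Y ⟶ D R n p :=
  equalizer.lift (Pi.lift a) <| by
    refine Pi.hom_ext _ _ fun ij => ?_
    simp only [Category.assoc, limit.lift_π, Fan.mk_π_app, AddMonObj.comp_zero]
    split_ifs with h
    · rw [MonObj.comp_mul]
      simp only [limit.lift_π, Fan.mk_π_app]
      rcases h with h | h
      · rw [h]; exact ha _
      · exact hp _ h
    · exact AddMonObj.comp_zero _

@[simp]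
lemma mk_coord {Y : C} (a : Fin n → (Y ⟶ R)) (ha : ∀ i, a i * a i = 0)
    (hp : ∀ ij ∈ p, a ij.1 * a ij.2 = 0) (i : Fin n) : mk a ha hp ≫ coord i = a i := by
  rw [mk, coord]
  exact (equalizer.lift_ι_assoc _ _ _).trans (by simp)

/-- The canonical injection of `D ^ n {p}` into `D ^ n`. -/
noncomputable def incl (p : Finset (Fin n × Fin n)) : D R n p ⟶ D R n ∅ :=
  mk coord coord_mul_self (by simp)

/-- `(d₁, …, dₙ) ↦ (d_{σ⁻¹(1)}, …, d_{σ⁻¹(n)})`. -/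
noncomputable def permute (σ : Equiv.Perm (Fin n)) : D R n ∅ ⟶ D R n ∅ :=
  mk (fun i => coord (σ⁻¹ i)) (fun _ => coord_mul_self _) (by simp)

/-- The relations `{(n+1, n+3), (n+2, n+3)}`, with indices counted from `0`. -/
def rel (n : ℕ) : Finset (Fin (n + 3) × Fin (n + 3)) :=
  {((Fin.last n).castSucc.castSucc, Fin.last (n + 2)),
    ((Fin.last (n + 1)).castSucc, Fin.last (n + 2))}

/-- `(d₁, …, dₙ₊₂) ↦ (d₁, …, dₙ₊₂, dₙ₊₁ dₙ₊₂)`. -/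
noncomputable def j₁ (n : ℕ) : D R (n + 2) ∅ ⟶ D R (n + 3) (rel n) :=
  mk (Fin.snoc (α := fun _ => D R (n + 2) ∅ ⟶ R) coord
      (coord (Fin.last n).castSucc * coord (Fin.last (n + 1))))
    (by
      intro i
      refine Fin.lastCases ?_ (fun i => ?_) i
      · rw [Fin.snoc_last, mul_mul_mul_comm, coord_mul_self, zero_mul]
      · rw [Fin.snoc_castSucc, coord_mul_self])
    (by
      simp only [rel, Finset.mem_insert, Finset.mem_singleton, forall_eq_or_imp, forall_eq,
        Fin.snoc_last, Fin.snoc_castSucc]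
      exact ⟨by rw [← mul_assoc, coord_mul_self, zero_mul],
        by rw [mul_left_comm, coord_mul_self, mul_zero]⟩)

/-- `(d₁, …, dₙ₊₂) ↦ (d₁, …, dₙ₊₂, 0)`. -/
noncomputable def j₂ (n : ℕ) : D R (n + 2) ∅ ⟶ D R (n + 3) (rel n) :=
  mk (Fin.snoc (α := fun _ => D R (n + 2) ∅ ⟶ R) coord 0)
    (by
      intro i
      refine Fin.lastCases ?_ (fun i => ?_) i
      · rw [Fin.snoc_last, zero_mul]
      · rw [Fin.snoc_castSucc, coord_mul_self])
    (by
      simp only [rel, Finset.mem_insert, Finset.mem_singleton, forall_eq_or_imp, forall_eq,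
        Fin.snoc_last, mul_zero, and_self])

/-- `(d₁, …, dₙ, dₙ₊₁) ↦ (d₁, …, dₙ, 0, 0, dₙ₊₁)`. -/
noncomputable def e (n : ℕ) : D R (n + 1) ∅ ⟶ D R (n + 3) (rel n) :=
  mk (Fin.snoc (α := fun _ => D R (n + 1) ∅ ⟶ R)
      (Fin.snoc (α := fun _ => D R (n + 1) ∅ ⟶ R)
        (Fin.snoc (α := fun _ => D R (n + 1) ∅ ⟶ R) (fun i => coord i.castSucc) 0) 0)
      (coord (Fin.last n)))
    (by
      intro i
      refine Fin.lastCases ?_ (fun i => ?_) i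
      · rw [Fin.snoc_last, coord_mul_self]
      · rw [Fin.snoc_castSucc]
        refine Fin.lastCases ?_ (fun i => ?_) i
        · rw [Fin.snoc_last, zero_mul]
        · rw [Fin.snoc_castSucc]
          refine Fin.lastCases ?_ (fun i => ?_) i
          · rw [Fin.snoc_last, zero_mul]
          · rw [Fin.snoc_castSucc, coord_mul_self])
    (by
      simp only [rel, Finset.mem_insert, Finset.mem_singleton, forall_eq_or_imp, forall_eq,
        Fin.snoc_last, Fin.snoc_castSucc, zero_mul, and_self])

/-- `d ↦ (d, 0)`, from `D` to `D(2) = D ^ 2 {(1, 2)}`. -/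
noncomputable def i₁ : D R 1 ∅ ⟶ D R 2 {(0, 1)} :=
  mk ![coord 0, 0] (by simp [Fin.forall_fin_two, coord_mul_self]) (by simp)

/-- `d ↦ (0, d)`, from `D` to `D(2) = D ^ 2 {(1, 2)}`. -/
noncomputable def i₂ : D R 1 ∅ ⟶ D R 2 {(0, 1)} :=
  mk ![0, coord 0] (by simp [Fin.forall_fin_two, coord_mul_self]) (by simp)

/-- `d ↦ (d, d)`, from `D` to `D(2) = D ^ 2 {(1, 2)}`. -/
noncomputable def diag : D R 1 ∅ ⟶ D R 2 {(0, 1)} :=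
  mk ![coord 0, coord 0] (by simp [Fin.forall_fin_two, coord_mul_self])
    (by simp [coord_mul_self])

end Infinitesimal

section StrongDifference

variable [HasFiniteLimits C]

/-- The mappings `D ^ n → M` (at stage `X`).  For `n = 1` these are the tangent vectors of `M`. -/
abbrev Cube (R : C) [CommRingObj R] (X M : C) (n : ℕ) : Type v := D R n ∅ ⊗ X ⟶ M

variable {R : C} [CommRingObj R] {X M : C}

/-- The restrictions of `γ` and `γ'` to `D ^ n {p}` are equal. -/
def AgreeOn {n : ℕ} (p : Finset (Fin n × Fin n)) (γ γ' : Cube R X M n) : Prop :=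
  incl p ▷ X ≫ γ = incl p ▷ X ≫ γ'

/-- The strong difference `γ₁ ∸_{1…n} γ₂ : D ^ (n+1) → M` of `γ₁, γ₂ : D ^ (n+2) → M`, as a partial
operation.  It is defined when there is a unique mapping `𝔫` on `D ^ (n+3) {(n+1,n+3), (n+2,n+3)}`
with `𝔫 ∘ j₁ = γ₁` and `𝔫 ∘ j₂ = γ₂`, and it is then
`(d₁, …, dₙ₊₁) ↦ 𝔫 (d₁, …, dₙ, 0, 0, dₙ₊₁)`. -/
noncomputable def strongDiff {n : ℕ} (γ₁ γ₂ : Cube R X M (n + 2)) : Part (Cube R X M (n + 1)) where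
  Dom := ∃! 𝔫 : D R (n + 3) (rel n) ⊗ X ⟶ M, j₁ n ▷ X ≫ 𝔫 = γ₁ ∧ j₂ n ▷ X ≫ 𝔫 = γ₂
  get h := e n ▷ X ≫ h.choose

/-- `γ₁ ∸_{σ(1)…σ(n)} γ₂ = γ₁^σ ∸_{1…n} γ₂^σ`, where
`γ^σ (d₁, …, dₙ₊₂) = γ (d_{σ⁻¹(1)}, …, d_{σ⁻¹(n+2)})`. -/
noncomputable def strongDiffPerm {n : ℕ} (σ : Equiv.Perm (Fin (n + 2)))
    (γ₁ γ₂ : Cube R X M (n + 2)) : Part (Cube R X M (n + 1)) :=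
  strongDiff (permute σ ▷ X ≫ γ₁) (permute σ ▷ X ≫ γ₂)

/-- The strong difference of two expressions; it is defined when both expressions are defined
and their values have a strong difference. -/
noncomputable def strongDiffPart {n : ℕ} (a b : Part (Cube R X M (n + 2))) :
    Part (Cube R X M (n + 1)) :=
  a.bind fun γ₁ => b.bind fun γ₂ => strongDiff γ₁ γ₂

/-- The sum of two tangent vectors, as a partial operation: if there is a unique mapping `l` on
`D(2)` with `l (d, 0) = t₁ d` and `l (0, d) = t₂ d`, then `(t₁ + t₂) d = l (d, d)`. -/
noncomputable def tangentAdd (t₁ t₂ : Cube R X M 1) : Part (Cube R X M 1) where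
  Dom := ∃! l : D R 2 {(0, 1)} ⊗ X ⟶ M, i₁ ▷ X ≫ l = t₁ ∧ i₂ ▷ X ≫ l = t₂
  get h := diag ▷ X ≫ h.choose

/-- The value `γ (0, …, 0)`. -/
noncomputable def atZero {n : ℕ} (γ : Cube R X M n) : X ⟶ M :=
  lift (mk (fun _ => 0) (by simp) (by simp)) (𝟙 X) ≫ γ

/-- The zero tangent vector at the point `x` of `M`. -/
noncomputable def tangentZero (R : C) [CommRingObj R] (x : X ⟶ M) : Cube R X M 1 :=
  snd _ _ ≫ x

/-- The sum `t₁ + (t₂ + (… + (tₘ + 0)))` of a list of expressions for tangent vectors at `x`; it is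
defined when all the expressions and all the additions are. -/
noncomputable def tangentSum (x : X ⟶ M) (l : List (Part (Cube R X M 1))) :
    Part (Cube R X M 1) :=
  l.foldr (fun a b => a.bind fun t₁ => b.bind fun t₂ => tangentAdd t₁ t₂)
    (Part.some (tangentZero R x))

/-- The permutation of `{0, 1, 2, 3}` whose word (list of values) is `w`. -/
noncomputable def word (w : Fin 4 → Fin 4) (h : Function.Bijective w := by decide) :
    Equiv.Perm (Fin 4) :=
  Equiv.ofBijective w h

/-- Let `γ` be indexed by the permutations of four letters, a permutation `τ` being read as the word
`abcd = τ(1)τ(2)τ(3)τ(4)`. This is the expression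
`((γ_abcd ∸_ab γ_abdc) ∸_1 (γ_acdb ∸_ab γ_adcb)) ∸ ((γ_bcda ∸_ab γ_bdca) ∸_1 (γ_cdba ∸_ab γ_dcba))`,
where `∸_ab` is formed with the permutation `τ`, which maps `1` to `a` and `2` to `b`. -/
noncomputable def jacobiTerm (γ : Equiv.Perm (Fin 4) → Cube R X M 4) (τ : Equiv.Perm (Fin 4)) :
    Part (Cube R X M 1) :=
  strongDiffPart
    (strongDiffPart
      (strongDiffPerm τ (γ τ) (γ (τ * word ![0, 1, 3, 2])))
      (strongDiffPerm τ (γ (τ * word ![0, 2, 3, 1])) (γ (τ * word ![0, 3, 2, 1]))))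
    (strongDiffPart
      (strongDiffPerm τ (γ (τ * word ![1, 2, 3, 0])) (γ (τ * word ![1, 3, 2, 0])))
      (strongDiffPerm τ (γ (τ * word ![2, 3, 1, 0])) (γ (τ * word ![3, 2, 1, 0]))))

end StrongDifference

end SDG

/-!
By Kock–Lawvere, an `R`-valued function on `D ^ n {p}` is a polynomial: it has one coefficient for
each squarefree monomial not killed by `p`, and these are arbitrary. The compatible families of
functions on the 24 copies of `D ^ 4` therefore form a Weil algebra `W`, and `G = Spec_R W` is the
quasi-colimit of the diagram which glues the copies as in the theorem. As `M` is microlinear, the 24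
mappings all factor through a single `g : G × X → M`. A mapping from `D ^ n × X` to `G` amounts to
one function on `D ^ n × X` for each element of `W`, and strong differences and sums of the images
under `g` of such mappings are computed on the coefficients of these functions. There a strong
difference takes the difference of the coefficients of the monomials divisible by both of its
distinguished variables, so each of the twelve terms has as coefficient in degree 1 an alternating
sum of the highest coefficients of eight words; a sum adds the coefficients of degree 1. Each of the
24 words occurs in the twelve terms twice with each sign, so the coefficient of the sum is 0.
-/

namespace SDG

section Perception

variable {C : Type u} [Category.{v} C] [CartesianMonoidalCategory C] [MonoidalClosed C]

theorem perceives_iff_ihom (M : C) {J : Type} [SmallCategory J] {F : J ⥤ C} (c : Cocone F) :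
    Perceives M c ↔ ∀ (X : C) (t : ∀ j, X ⟶ (ihom (F.obj j)).obj M),
      (∀ {i j : J} (f : i ⟶ j), t j ≫ (MonoidalClosed.pre (F.map f)).app M = t i) →
        ∃! m : X ⟶ (ihom c.pt).obj M, ∀ j, m ≫ (MonoidalClosed.pre (c.ι.app j)).app M = t j := by
  constructor
  · rintro ⟨h⟩ X t ht
    let s : Cone (F.op ⋙ MonoidalClosed.internalHom.flip.obj M) :=
      { pt := X
        π := { app := fun j => t j.unop
               naturality := fun i j f => (Category.id_comp _).trans (ht f.unop).symm } }
    exact ⟨h.lift s, fun j => h.fac s (Opposite.op j),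
      fun m hm => h.uniq s m fun j => hm j.unop⟩
  · intro h
    have key (s : Cone (F.op ⋙ MonoidalClosed.internalHom.flip.obj M)) :=
      h s.pt (fun j => s.π.app (Opposite.op j)) (fun f => s.w f.op)
    choose m hm hu using key
    exact ⟨{ lift := m
             fac := fun s j => hm s j.unop
             uniq := fun s m' hm' => hu s m' fun j => hm' (Opposite.op j) }⟩

theorem perceives_iff (M : C) {J : Type} [SmallCategory J] {F : J ⥤ C} (c : Cocone F) :
    Perceives M c ↔ ∀ (X : C) (φ : ∀ j, F.obj j ⊗ X ⟶ M),
      (∀ {i j : J} (f : i ⟶ j), F.map f ▷ X ≫ φ j = φ i) →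
        ∃! ψ : c.pt ⊗ X ⟶ M, ∀ j, c.ι.app j ▷ X ≫ ψ = φ j := by
  rw [perceives_iff_ihom]
  refine forall_congr' fun X => ⟨fun h φ hφ => ?_, fun h t ht => ?_⟩
  · obtain ⟨m, hm, hu⟩ := h (fun j => MonoidalClosed.curry (φ j))
      (fun f => by rw [MonoidalClosed.curry_pre_app, hφ f])
    refine ⟨MonoidalClosed.uncurry m, fun j => ?_, fun ψ hψ => ?_⟩
    · rw [← MonoidalClosed.uncurry_pre_app, hm, MonoidalClosed.uncurry_curry]
    · rw [← hu (MonoidalClosed.curry ψ) fun j => by rw [MonoidalClosed.curry_pre_app, hψ],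
        MonoidalClosed.uncurry_curry]
  · obtain ⟨ψ, hψ, hu⟩ := h (fun j => MonoidalClosed.uncurry (t j))
      (fun f => by rw [← MonoidalClosed.uncurry_pre_app, ht])
    refine ⟨MonoidalClosed.curry ψ, fun j => ?_, fun m hm => ?_⟩
    · rw [MonoidalClosed.curry_pre_app, hψ, MonoidalClosed.curry_uncurry]
    · rw [← hu (MonoidalClosed.uncurry m) fun j => by rw [← MonoidalClosed.uncurry_pre_app, hm],
        MonoidalClosed.curry_uncurry]

theorem perceives_multicofork_iff (M : C) {J : MultispanShape.{0, 0}} (I : MultispanIndex J C)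
    (G : C) (ι : ∀ i, I.right i ⟶ G) (w : ∀ a, I.fst a ≫ ι (J.fst a) = I.snd a ≫ ι (J.snd a)) :
    Perceives M (Multicofork.ofπ I G ι w) ↔ ∀ (X : C) (φ : ∀ i, I.right i ⊗ X ⟶ M),
      (∀ a, I.fst a ▷ X ≫ φ (J.fst a) = I.snd a ▷ X ≫ φ (J.snd a)) →
        ∃! ψ : G ⊗ X ⟶ M, ∀ i, ι i ▷ X ≫ ψ = φ i := by
  rw [perceives_iff]
  refine forall_congr' fun X => ⟨fun h φ hφ => ?_, fun h φ hφ => ?_⟩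
  · obtain ⟨ψ, hψ, hu⟩ := h
      (fun j => match j with
        | .left a => I.fst a ▷ X ≫ φ (J.fst a)
        | .right i => φ i) (by
        rintro _ _ (_ | a | a)
        · erw [I.multispan.map_id]
          simp
        · rfl
        · exact (hφ a).symm)
    refine ⟨ψ, fun i => hψ (.right i), fun ψ' hψ' => hu ψ' fun j => ?_⟩
    rcases j with a | i
    · change (I.fst a ≫ ι _) ▷ X ≫ ψ' = _
      rw [comp_whiskerRight, Category.assoc, hψ']
      rfl
    · exact hψ' i
  · obtain ⟨ψ, hψ, hu⟩ := h (fun i => φ (.right i)) (fun a =>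
      (hφ (WalkingMultispan.Hom.fst a)).trans (hφ (WalkingMultispan.Hom.snd a)).symm)
    refine ⟨ψ, fun j => ?_, fun ψ' hψ' => hu ψ' fun i => hψ' (.right i)⟩
    rcases j with a | i
    · change (I.fst a ≫ ι _) ▷ X ≫ ψ = _
      rw [comp_whiskerRight, Category.assoc, hψ]
      exact hφ (WalkingMultispan.Hom.fst a)
    · exact hψ i

theorem perceives_pushoutCocone_iff (M : C) {V S₁ S₂ T : C} {v₁ : V ⟶ S₁} {v₂ : V ⟶ S₂}
    {u₁ : S₁ ⟶ T} {u₂ : S₂ ⟶ T} (w : v₁ ≫ u₁ = v₂ ≫ u₂) :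
    Perceives M (PushoutCocone.mk u₁ u₂ w) ↔ ∀ (X : C) (φ₁ : S₁ ⊗ X ⟶ M) (φ₂ : S₂ ⊗ X ⟶ M),
      v₁ ▷ X ≫ φ₁ = v₂ ▷ X ≫ φ₂ →
        ∃! ψ : T ⊗ X ⟶ M, u₁ ▷ X ≫ ψ = φ₁ ∧ u₂ ▷ X ≫ ψ = φ₂ := by
  rw [perceives_iff]
  refine forall_congr' fun X => ⟨fun h φ₁ φ₂ hφ => ?_, fun h φ hφ => ?_⟩
  · obtain ⟨ψ, hψ, hu⟩ := h
      (fun j => match j with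
        | none => v₁ ▷ X ≫ φ₁
        | some .left => φ₁
        | some .right => φ₂) (by
        rintro _ _ (_ | _ | _)
        · erw [(span v₁ v₂).map_id]
          simp
        · rfl
        · exact hφ.symm)
    refine ⟨ψ, ⟨hψ (some .left), hψ (some .right)⟩, fun ψ' hψ' => hu ψ' ?_⟩
    rintro (_ | _ | _)
    · change (v₁ ≫ u₁) ▷ X ≫ ψ' = _
      rw [comp_whiskerRight, Category.assoc, hψ'.1]
      rfl
    · exact hψ'.1
    · exact hψ'.2
  · have hleft := hφ (WidePushoutShape.Hom.init WalkingPair.left)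
    have hright := hφ (WidePushoutShape.Hom.init WalkingPair.right)
    obtain ⟨ψ, ⟨h₁, h₂⟩, hu⟩ := h (φ (some .left)) (φ (some .right)) (hleft.trans hright.symm)
    refine ⟨ψ, ?_, fun ψ' hψ' => hu ψ' ⟨hψ' (some .left), hψ' (some .right)⟩⟩
    rintro (_ | _ | _)
    · change (v₁ ≫ u₁) ▷ X ≫ ψ = _
      rw [comp_whiskerRight, Category.assoc, h₁]
      exact hleft
    · exact h₁
    · exact h₂

end Perception

section Interpolation

variable {C : Type u} [Category.{v} C] [CartesianMonoidalCategory C]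

/-- The partial operation which sends mappings `γ₁` and `γ₂` on `S₁` and `S₂` to the restriction
along `d` of their unique common extension along `u₁` and `u₂`; strong differences and sums of
tangent vectors are of this form. -/
noncomputable def interpolate {S₁ S₂ S T X M : C} (u₁ : S₁ ⟶ T) (u₂ : S₂ ⟶ T) (d : S ⟶ T)
    (γ₁ : S₁ ⊗ X ⟶ M) (γ₂ : S₂ ⊗ X ⟶ M) : Part (S ⊗ X ⟶ M) where
  Dom := ∃! ν : T ⊗ X ⟶ M, u₁ ▷ X ≫ ν = γ₁ ∧ u₂ ▷ X ≫ ν = γ₂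
  get h := d ▷ X ≫ h.choose

/-- The composite of an `X`-indexed family of mappings `G → M` with a mapping `S → G` at
stage `X`. -/
def push {S G X M : C} (g : G ⊗ X ⟶ M) (δ : S ⊗ X ⟶ G) : S ⊗ X ⟶ M :=
  lift δ (snd S X) ≫ g

lemma whiskerRight_push {S T G X M : C} (u : S ⟶ T) (g : G ⊗ X ⟶ M) (δ : T ⊗ X ⟶ G) :
    u ▷ X ≫ push g δ = push g (u ▷ X ≫ δ) := by
  rw [push, push, comp_lift_assoc, whiskerRight_snd]

end Interpolation

section QuasiPushouts

variable {C : Type u} [Category.{v} C] [CartesianMonoidalCategory C] [BraidedCategory C]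
  {k : Type w} [CommRing k] {R : C} [CommRingObj R] [AlgebraObj k R]

lemma precomp_apply {X Y : C} (f : X ⟶ Y) (r : Y ⟶ R) : precomp k R f r = f ≫ r := rfl

lemma IsSpec.hom_ext {W : Type w} [CommRing W] [Algebra k W] {G : C} {x : W →ₐ[k] (G ⟶ R)}
    (hx : IsSpec k R x) {Y : C} {f g : Y ⟶ G} (h : ∀ a, f ≫ x a = g ≫ x a) : f = g :=
  (hx Y ((precomp k R g).comp x)).unique (AlgHom.ext h) rfl

variable [MonoidalClosed C]

variable (k R) in
lemma microlinear_line : Microlinear k R R := fun _ _ _ _ _ _ _ h => h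

theorem IsSpec.microlinear {W : Type w} [CommRing W] [Algebra k W] {G : C} {x : W →ₐ[k] (G ⟶ R)}
    (hx : IsSpec k R x) : Microlinear k R G := by
  intro J _ _ F c _ _ hR
  rw [perceives_iff] at hR ⊢
  intro X φ hφ
  let P : (c.pt ⊗ X ⟶ R) →ₐ[k] ∀ j, (F.obj j ⊗ X ⟶ R) :=
    AlgHom.pi fun j => precomp k R (c.ι.app j ▷ X)
  have hP : Function.Injective P := fun a b hab =>
    (hR X (fun j => c.ι.app j ▷ X ≫ b) fun f => by
      rw [← comp_whiskerRight_assoc, c.w]).unique (fun j => congrFun hab j) fun _ => rfl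
  let Φ : W →ₐ[k] ∀ j, (F.obj j ⊗ X ⟶ R) := AlgHom.pi fun j => (precomp k R (φ j)).comp x
  have hΦ (a : W) : Φ a ∈ P.range := by
    obtain ⟨ψ, hψ, -⟩ := hR X (fun j => φ j ≫ x a) fun f => by rw [← Category.assoc, hφ f]
    exact ⟨ψ, funext hψ⟩
  obtain ⟨ψ, hψ, -⟩ := hx (c.pt ⊗ X)
    ((AlgEquiv.ofInjective P hP).symm.toAlgHom.comp (Φ.codRestrict P.range hΦ))
  have hψP (a : W) : P (ψ ≫ x a) = Φ a := by
    refine (congrArg P (DFunLike.congr_fun hψ a)).trans ?_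
    exact congrArg Subtype.val ((AlgEquiv.ofInjective P hP).apply_symm_apply ⟨Φ a, hΦ a⟩)
  refine ⟨ψ, fun j => hx.hom_ext fun a => ?_, fun ψ' hψ' => hx.hom_ext fun a => hP ?_⟩
  · rw [Category.assoc]
    exact congrFun (hψP a) j
  · rw [hψP]
    funext j
    change c.ι.app j ▷ X ≫ ψ' ≫ x a = φ j ≫ x a
    rw [← Category.assoc, hψ']

variable (k R) in
/-- The square `v₁ ≫ u₁ = v₂ ≫ u₂` is a quasi-colimit: it consists of small objects and `R`
perceives it as a pushout. -/
structure IsQuasiPushout {V S₁ S₂ T : C} (v₁ : V ⟶ S₁) (v₂ : V ⟶ S₂) (u₁ : S₁ ⟶ T) (u₂ : S₂ ⟶ T) :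
    Prop where
  w : v₁ ≫ u₁ = v₂ ≫ u₂
  isSmall_source : IsSmall k R V
  isSmall_left : IsSmall k R S₁
  isSmall_right : IsSmall k R S₂
  isSmall_target : IsSmall k R T
  perceives : Perceives R (PushoutCocone.mk u₁ u₂ w)

namespace IsQuasiPushout

variable {V S₁ S₂ T : C} {v₁ : V ⟶ S₁} {v₂ : V ⟶ S₂} {u₁ : S₁ ⟶ T} {u₂ : S₂ ⟶ T}

lemma existsUnique (hu : IsQuasiPushout k R v₁ v₂ u₁ u₂) {M : C} (hM : Microlinear k R M) {X : C}
    {φ₁ : S₁ ⊗ X ⟶ M} {φ₂ : S₂ ⊗ X ⟶ M} (hφ : v₁ ▷ X ≫ φ₁ = v₂ ▷ X ≫ φ₂) :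
    ∃! ψ : T ⊗ X ⟶ M, u₁ ▷ X ≫ ψ = φ₁ ∧ u₂ ▷ X ≫ ψ = φ₂ := by
  refine (perceives_pushoutCocone_iff M hu.w).1 (hM _ _ _ ?_ hu.isSmall_target hu.perceives)
    X φ₁ φ₂ hφ
  rintro (_ | _ | _)
  exacts [hu.isSmall_source, hu.isSmall_left, hu.isSmall_right]

lemma compatible (hu : IsQuasiPushout k R v₁ v₂ u₁ u₂) {M X : C} (ν : T ⊗ X ⟶ M) :
    v₁ ▷ X ≫ u₁ ▷ X ≫ ν = v₂ ▷ X ≫ u₂ ▷ X ≫ ν := by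
  rw [← comp_whiskerRight_assoc, hu.w, comp_whiskerRight_assoc]

lemma hom_ext (hu : IsQuasiPushout k R v₁ v₂ u₁ u₂) {M : C} (hM : Microlinear k R M) {X : C}
    {ν ν' : T ⊗ X ⟶ M} (h₁ : u₁ ▷ X ≫ ν = u₁ ▷ X ≫ ν') (h₂ : u₂ ▷ X ≫ ν = u₂ ▷ X ≫ ν') :
    ν = ν' :=
  (hu.existsUnique hM (hu.compatible ν')).unique ⟨h₁, h₂⟩ ⟨rfl, rfl⟩

lemma interpolate_eq_some (hu : IsQuasiPushout k R v₁ v₂ u₁ u₂) {M : C} (hM : Microlinear k R M)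
    {S X : C} (d : S ⟶ T) (ν : T ⊗ X ⟶ M) :
    interpolate u₁ u₂ d (u₁ ▷ X ≫ ν) (u₂ ▷ X ≫ ν) = Part.some (d ▷ X ≫ ν) := by
  have hdom := hu.existsUnique hM (hu.compatible ν)
  exact Part.eq_some_iff.2
    ⟨hdom, congrArg (d ▷ X ≫ ·) (hdom.unique hdom.choose_spec.1 ⟨rfl, rfl⟩)⟩

theorem interpolate_push (hu : IsQuasiPushout k R v₁ v₂ u₁ u₂) {M : C} (hM : Microlinear k R M)
    {W : Type w} [CommRing W] [Algebra k W] {G : C} {x : W →ₐ[k] (G ⟶ R)} (hx : IsSpec k R x)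
    {S X : C} (d : S ⟶ T) (g : G ⊗ X ⟶ M) {δ₁ : S₁ ⊗ X ⟶ G} {δ₂ : S₂ ⊗ X ⟶ G}
    (ν : W → (T ⊗ X ⟶ R)) (h₁ : ∀ a, u₁ ▷ X ≫ ν a = δ₁ ≫ x a)
    (h₂ : ∀ a, u₂ ▷ X ≫ ν a = δ₂ ≫ x a) :
    ∃ δ : S ⊗ X ⟶ G, interpolate u₁ u₂ d (push g δ₁) (push g δ₂) = Part.some (push g δ) ∧
      ∀ a, δ ≫ x a = d ▷ X ≫ ν a := by
  have hδ : v₁ ▷ X ≫ δ₁ = v₂ ▷ X ≫ δ₂ := hx.hom_ext fun a => by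
    rw [Category.assoc, Category.assoc, ← h₁, ← h₂, hu.compatible]
  obtain ⟨θ, ⟨rfl, rfl⟩, -⟩ := hu.existsUnique hx.microlinear hδ
  have hθ (a : W) : θ ≫ x a = ν a := hu.hom_ext (microlinear_line k R)
    (by rw [h₁, Category.assoc]) (by rw [h₂, Category.assoc])
  refine ⟨d ▷ X ≫ θ, ?_, fun a => by rw [Category.assoc, hθ]⟩
  rw [← whiskerRight_push, ← whiskerRight_push, ← whiskerRight_push]
  exact hu.interpolate_eq_some hM d (push g θ)

end IsQuasiPushout

end QuasiPushouts

section WeilAlgebras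

theorem isWeilAlgebra_of_coordinates {k : Type w} [CommRing k] {W : Type w} [CommRing W]
    [Algebra k W] {Q : Type*} [Finite Q] (c : W ≃ₗ[k] (Q → k)) (q₀ : Q) (ε : W →ₐ[k] k)
    (hε : ∀ a, ε a = c a q₀) (hn : ∀ a, ε a = 0 → IsNilpotent a) : IsWeilAlgebra k W := by
  classical
  let c' : RingHom.ker ε ≃ₗ[k] ({q // q ≠ q₀} → k) :=
    { toFun := fun a q => c a.1 q
      map_add' := fun a b => by ext q; simp
      map_smul' := fun r a => by
        ext q
        change c (r • a.1) q = _
        simp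
      invFun := fun f => ⟨c.symm fun q => if h : q ≠ q₀ then f ⟨q, h⟩ else 0, by
        rw [RingHom.mem_ker]
        exact (hε _).trans (by simp)⟩
      left_inv := fun a => by
        apply Subtype.ext
        rw [LinearEquiv.symm_apply_eq]
        ext q
        by_cases h : q = q₀
        · subst h
          have : ε a.1 = 0 := a.2
          simp [← hε, this]
        · simp [h]
      right_inv := fun f => by
        ext q
        simp [q.2] }
  have hfree : Module.Free k (RingHom.ker ε) := Module.Free.of_equiv c'.symm
  have hfin : Module.Finite k (RingHom.ker ε) := Module.Finite.equiv c'.symm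
  refine ⟨ε, ?_, hfree, hfin⟩
  have hfin' : Module.Finite W (RingHom.ker ε) := Module.Finite.of_restrictScalars_finite k W _
  rw [Ideal.FG.isNilpotent_iff_le_nilradical (Module.Finite.iff_fg.1 hfin')]
  exact hn

/-- The squarefree monomial `∏ xᵢ` over all `i` with `s i = true`. -/
def mon {A : Type*} [CommMonoid A] {n : ℕ} (x : Fin n → A) (s : Fin n → Bool) : A :=
  ∏ i, if s i then x i else 1

lemma map_mon {A B F : Type*} [CommMonoid A] [CommMonoid B] [FunLike F A B] [MonoidHomClass F A B]
    (f : F) {n : ℕ} (x : Fin n → A) (s : Fin n → Bool) :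
    f (mon x s) = mon (fun i => f (x i)) s := by
  simp only [mon, map_prod, apply_ite f, map_one]

lemma mon_eq_zero {A : Type*} [CommMonoidWithZero A] {n : ℕ} {x : Fin n → A} {s : Fin n → Bool}
    {i j : Fin n} (hij : i ≠ j) (hi : s i = true) (hj : s j = true) (h : x i * x j = 0) :
    mon x s = 0 := by
  rw [mon, ← Finset.mul_prod_erase _ _ (Finset.mem_univ i),
    ← Finset.mul_prod_erase _ _ (Finset.mem_erase.2 ⟨hij.symm, Finset.mem_univ j⟩), ← mul_assoc,
    if_pos hi, if_pos hj, h, zero_mul]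

/-- The condition that the squarefree monomial with support `s` does not vanish on `D ^ n {p}`.
Diagonal pairs in `p` impose nothing new, since all coordinates have square zero. -/
def Indep {n : ℕ} (p : Finset (Fin n × Fin n)) (s : Fin n → Bool) : Prop :=
  ∀ ij ∈ p, ij.1 ≠ ij.2 → ¬(s ij.1 = true ∧ s ij.2 = true)

lemma indep_empty {n : ℕ} (s : Fin n → Bool) : Indep ∅ s := by simp [Indep]

lemma indep_const_false {n : ℕ} (p : Finset (Fin n × Fin n)) : Indep p fun _ => false := by
  simp [Indep]

lemma indep_singleton {n : ℕ} {i j : Fin n} (hij : i ≠ j) {s : Fin n → Bool} :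
    Indep {(i, j)} s ↔ ¬(s i = true ∧ s j = true) := by
  simp [Indep, hij]

/-- The exponent vector of a squarefree monomial. -/
noncomputable def expo {n : ℕ} (s : Fin n → Bool) : Fin n →₀ ℕ :=
  Finsupp.equivFunOnFinite.symm fun i => (s i).toNat

lemma expo_apply {n : ℕ} (s : Fin n → Bool) (i : Fin n) : expo s i = (s i).toNat := rfl

lemma expo_const_false {n : ℕ} : expo (fun _ : Fin n => false) = 0 := Finsupp.ext fun _ => rfl

lemma expo_injective {n : ℕ} : Function.Injective (expo (n := n)) := fun s t h => by
  ext i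
  have := DFunLike.congr_fun h i
  rw [expo_apply, expo_apply] at this
  revert this
  cases s i <;> cases t i <;> simp

lemma mon_mvPolynomial_X (k : Type w) [CommRing k] {n : ℕ} (s : Fin n → Bool) :
    mon (MvPolynomial.X (R := k)) s = MvPolynomial.monomial (expo s) 1 := by
  rw [MvPolynomial.monomial_eq, Finsupp.prod_fintype _ _ (by simp), mon, map_one, one_mul]
  refine Finset.prod_congr rfl fun i _ => ?_
  rw [expo_apply]
  cases s i <;> simp

/-- The exponent vectors of the quadratic monomials which define `D ^ n {p}`. -/
def relExponents {n : ℕ} (p : Finset (Fin n × Fin n)) : Set (Fin n →₀ ℕ) :=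
  {m | ∃ i j, (i = j ∨ (i, j) ∈ p) ∧ Finsupp.single i 1 + Finsupp.single j 1 = m}

lemma not_exists_relExponents_le_iff {n : ℕ} {p : Finset (Fin n × Fin n)} {m : Fin n →₀ ℕ} :
    (¬∃ r ∈ relExponents p, r ≤ m) ↔ ∃ s, Indep p s ∧ expo s = m := by
  constructor
  · intro h
    have hm (i : Fin n) : m i < 2 := by
      by_contra! hi
      refine h ⟨_, ⟨i, i, Or.inl rfl, rfl⟩, ?_⟩
      rw [← Finsupp.single_add, Finsupp.single_le_iff]
      exact hi
    refine ⟨fun i => decide (m i = 1), fun ij hij hne ⟨h₁, h₂⟩ => h ?_, ?_⟩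
    · simp only [decide_eq_true_eq] at h₁ h₂
      refine ⟨_, ⟨ij.1, ij.2, Or.inr hij, rfl⟩, fun l => ?_⟩
      rw [Finsupp.add_apply, Finsupp.single_apply, Finsupp.single_apply]
      split_ifs <;> grind
    · ext i
      have := hm i
      interval_cases h : m i <;> simp [expo_apply, h]
  · rintro ⟨s, hs, rfl⟩ ⟨_, ⟨i, j, hij, rfl⟩, hle⟩
    have hi := hle i
    have hj := hle j
    have := Bool.toNat_le (s i)
    by_cases hne : i = j
    · subst hne
      simp only [Finsupp.add_apply, Finsupp.single_eq_same, expo_apply] at hi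
      omega
    · simp only [Finsupp.add_apply, Finsupp.single_apply, expo_apply, hne, Ne.symm hne] at hi hj
      refine hs (i, j) (hij.resolve_left hne) hne ?_
      revert hi hj
      cases s i <;> cases s j <;> simp

variable (k : Type w) [CommRing k] {n : ℕ} (p : Finset (Fin n × Fin n))

/-- The ideal of the relations `XᵢXⱼ = 0` which define `D ^ n {p}`. -/
noncomputable def relIdeal : Ideal (MvPolynomial (Fin n) k) :=
  Ideal.span ((fun m => MvPolynomial.monomial m 1) '' relExponents p)

variable {k p} in
lemma mem_relIdeal_iff {f : MvPolynomial (Fin n) k} :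
    f ∈ relIdeal k p ↔ ∀ s, Indep p s → MvPolynomial.coeff (expo s) f = 0 := by
  rw [relIdeal, MvPolynomial.mem_ideal_span_monomial_image]
  refine ⟨fun h s hs => ?_, fun h m hm => ?_⟩
  · by_contra hc
    exact not_exists_relExponents_le_iff.2 ⟨s, hs, rfl⟩ (h _ (MvPolynomial.mem_support_iff.2 hc))
  · by_contra hc
    obtain ⟨s, hs, rfl⟩ := not_exists_relExponents_le_iff.1 hc
    exact MvPolynomial.mem_support_iff.1 hm (h s hs)

/-- The Weil algebra `k[X₁, …, Xₙ] / (XᵢXⱼ | i = j or (i, j) ∈ p)` of functions on `D ^ n {p}`. -/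
abbrev SimplicialAlg : Type w := MvPolynomial (Fin n) k ⧸ relIdeal k p

namespace SimplicialAlg

/-- The coordinate functions. -/
noncomputable def X (i : Fin n) : SimplicialAlg k p := Ideal.Quotient.mk _ (MvPolynomial.X i)

lemma X_mul_X {i j : Fin n} (h : i = j ∨ (i, j) ∈ p) : X k p i * X k p j = 0 := by
  rw [X, X, ← map_mul, Ideal.Quotient.eq_zero_iff_mem]
  refine Ideal.subset_span ⟨_, ⟨i, j, h, rfl⟩, ?_⟩
  simp only [MvPolynomial.X, MvPolynomial.monomial_mul, one_mul]

variable {k p} in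
lemma algHom_ext {A : Type*} [CommRing A] [Algebra k A] {f g : SimplicialAlg k p →ₐ[k] A}
    (h : ∀ i, f (X k p i) = g (X k p i)) : f = g :=
  Ideal.Quotient.algHom_ext _ (MvPolynomial.algHom_ext h)

/-- The point of `D ^ n {p}` with the given coordinates in a `k`-algebra. -/
noncomputable def eval {A : Type*} [CommRing A] [Algebra k A] (x : Fin n → A)
    (hx : ∀ i, x i * x i = 0) (hp : ∀ ij ∈ p, x ij.1 * x ij.2 = 0) : SimplicialAlg k p →ₐ[k] A :=
  Ideal.Quotient.liftₐ _ (MvPolynomial.aeval x) <| by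
    suffices h : relIdeal k p ≤ RingHom.ker (MvPolynomial.aeval x) from fun f hf => h hf
    refine Ideal.span_le.2 ?_
    rintro _ ⟨_, ⟨i, j, hij, rfl⟩, rfl⟩
    change MvPolynomial.aeval x (MvPolynomial.monomial _ 1) = 0
    rw [← one_mul (1 : k), ← MvPolynomial.monomial_mul, map_mul]
    change MvPolynomial.aeval x (MvPolynomial.X i) * MvPolynomial.aeval x (MvPolynomial.X j) = 0
    rw [MvPolynomial.aeval_X, MvPolynomial.aeval_X]
    rcases hij with rfl | hij
    exacts [hx i, hp _ hij]

@[simp]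
lemma eval_X {A : Type*} [CommRing A] [Algebra k A] (x : Fin n → A)
    (hx : ∀ i, x i * x i = 0) (hp : ∀ ij ∈ p, x ij.1 * x ij.2 = 0) (i : Fin n) :
    eval k p x hx hp (X k p i) = x i :=
  MvPolynomial.aeval_X x i

/-- The coefficients of an element of the Weil algebra. -/
noncomputable def coeffs : SimplicialAlg k p →ₗ[k] ({s // Indep p s} → k) :=
  (((relIdeal k p).restrictScalars k).liftQ
      (LinearMap.pi fun s => MvPolynomial.lcoeff k (expo s.1))
      (fun f hf => by ext s; exact mem_relIdeal_iff.1 hf s.1 s.2)).comp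
    (Submodule.Quotient.restrictScalarsEquiv k (relIdeal k p)).symm.toLinearMap

lemma coeffs_mk (f : MvPolynomial (Fin n) k) (s : {s // Indep p s}) :
    coeffs k p (Ideal.Quotient.mk _ f) s = MvPolynomial.coeff (expo s.1) f := rfl

lemma coeffs_bijective : Function.Bijective (coeffs k p) := by
  classical
  constructor
  · rw [injective_iff_map_eq_zero]
    intro a ha
    obtain ⟨f, rfl⟩ := Ideal.Quotient.mk_surjective a
    rw [Ideal.Quotient.eq_zero_iff_mem, mem_relIdeal_iff]
    exact fun s hs => congrFun ha ⟨s, hs⟩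
  · intro a
    refine ⟨Ideal.Quotient.mk _ (∑ s, MvPolynomial.monomial (expo s.1) (a s)), ?_⟩
    ext t
    rw [coeffs_mk, MvPolynomial.coeff_sum, Finset.sum_eq_single t]
    · simp
    · intro s _ hs
      rw [MvPolynomial.coeff_monomial, if_neg fun h => hs (Subtype.ext (expo_injective h))]
    · simp

/-- The coordinates with respect to the basis of squarefree monomials which do not vanish. -/
noncomputable def coeffEquiv : SimplicialAlg k p ≃ₗ[k] ({s // Indep p s} → k) :=
  LinearEquiv.ofBijective _ (coeffs_bijective k p)

lemma coeffEquiv_mk (f : MvPolynomial (Fin n) k) (s : {s // Indep p s}) :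
    coeffEquiv k p (Ideal.Quotient.mk _ f) s = MvPolynomial.coeff (expo s.1) f := rfl

lemma coeffEquiv_symm_single [DecidableEq {s // Indep p s}] (s : {s // Indep p s}) :
    (coeffEquiv k p).symm (Pi.single s 1) = mon (X k p) s.1 := by
  have hmon : mon (X k p) s.1 = Ideal.Quotient.mk _ (MvPolynomial.monomial (expo s.1) 1) := by
    rw [← mon_mvPolynomial_X, map_mon]
    rfl
  rw [LinearEquiv.symm_apply_eq]
  ext t
  rw [hmon, coeffEquiv_mk, MvPolynomial.coeff_monomial, Pi.single_apply]
  simp only [expo_injective.eq_iff, eq_comm (a := t), Subtype.ext_iff]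

/-- The value at the origin. -/
noncomputable def eps : SimplicialAlg k p →ₐ[k] k := eval k p 0 (by simp) (by simp)

lemma eps_apply (a : SimplicialAlg k p) :
    eps k p a = coeffEquiv k p a ⟨fun _ => false, indep_const_false p⟩ := by
  obtain ⟨f, rfl⟩ := Ideal.Quotient.mk_surjective a
  rw [coeffEquiv_mk, expo_const_false]
  change MvPolynomial.aeval 0 f = _
  rw [MvPolynomial.aeval_zero]
  rfl

lemma sub_algebraMap_eps_mem_nilradical (a : SimplicialAlg k p) :
    a - algebraMap k _ (eps k p a) ∈ nilradical (SimplicialAlg k p) := by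
  have hX (i : Fin n) : X k p i ∈ nilradical (SimplicialAlg k p) :=
    ⟨2, (pow_two _).trans (X_mul_X k p (Or.inl rfl))⟩
  obtain ⟨f, rfl⟩ := Ideal.Quotient.mk_surjective a
  induction f using MvPolynomial.induction_on with
  | C r =>
    have : algebraMap k _ (eps k p (algebraMap k _ r)) = algebraMap k (SimplicialAlg k p) r := by
      rw [AlgHom.commutes, Algebra.algebraMap_self, RingHom.id_apply]
    exact (sub_eq_zero.2 this.symm) ▸ zero_mem _
  | add f g hf hg =>
    rw [map_add, map_add, map_add, add_sub_add_comm]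
    exact add_mem hf hg
  | mul_X f i _ =>
    have hε : eps k p (Ideal.Quotient.mk _ (MvPolynomial.X i)) = 0 := eval_X k p _ _ _ i
    rw [map_mul, map_mul, hε, mul_zero, map_zero, sub_zero]
    exact Ideal.mul_mem_left _ _ (hX i)

lemma isNilpotent_of_eps_eq_zero {a : SimplicialAlg k p} (ha : eps k p a = 0) :
    IsNilpotent a := by
  have h := sub_algebraMap_eps_mem_nilradical k p a
  rwa [ha, map_zero, sub_zero] at h

theorem isWeilAlgebra : IsWeilAlgebra k (SimplicialAlg k p) := by
  classical
  exact isWeilAlgebra_of_coordinates (coeffEquiv k p) _ (eps k p) (eps_apply k p)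
    fun _ => isNilpotent_of_eps_eq_zero k p

end SimplicialAlg

end WeilAlgebras

section Monomials

/-- Append an entry to a tuple. -/
abbrev snoc {A : Type*} {n : ℕ} (s : Fin n → A) (b : A) : Fin (n + 1) → A :=
  Fin.snoc (α := fun _ => A) s b

lemma exists_snoc {A : Type*} {n : ℕ} (s : Fin (n + 1) → A) : ∃ t b, s = snoc t b :=
  ⟨fun i => s i.castSucc, s (Fin.last n), (Fin.snoc_init_self s).symm⟩

lemma sum_snoc {A : Type*} [AddCommMonoid A] {n : ℕ} (f : (Fin (n + 1) → Bool) → A) :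
    ∑ s, f s = ∑ s, (f (snoc s false) + f (snoc s true)) := by
  rw [← (Fin.snocEquiv fun _ : Fin (n + 1) => Bool).sum_comp f, Fintype.sum_prod_type_right]
  refine Finset.sum_congr rfl fun s _ => ?_
  rw [Fintype.sum_bool, add_comm]
  rfl

lemma mon_snoc {A : Type*} [CommMonoid A] {n : ℕ} (x : Fin (n + 1) → A) (s : Fin n → Bool)
    (b : Bool) :
    mon x (snoc s b) = mon (fun i => x i.castSucc) s * if b then x (Fin.last n) else 1 := by
  simp only [mon, Fin.prod_univ_castSucc, Fin.snoc_castSucc, Fin.snoc_last]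

/-- The coefficients of `f (d₁, …, dₙ₊₂, dₙ₊₁ dₙ₊₂)`, where `f` has coefficients `c`. -/
def j₁Coeff {A : Type*} [AddZeroClass A] {n : ℕ} (c : (Fin (n + 3) → Bool) → A)
    (s : Fin (n + 2) → Bool) : A :=
  c (snoc s false) + if s (Fin.last n).castSucc ∧ s (Fin.last (n + 1)) then
    c (snoc (snoc (snoc (fun i => s i.castSucc.castSucc) false) false) true) else 0

/-- The coefficients of `f (d₁, …, dₙ, 0, 0, dₙ₊₁)`, where `f` has coefficients `c`. -/
def eCoeff {A : Type*} {n : ℕ} (c : (Fin (n + 3) → Bool) → A) (t : Fin (n + 1) → Bool) : A :=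
  c (snoc (snoc (snoc (fun i => t i.castSucc) false) false) (t (Fin.last n)))

variable {A : Type*} [CommRing A] {n : ℕ}

lemma sum_mon_j₁ (c : (Fin (n + 3) → Bool) → A) (x : Fin (n + 2) → A) (hx : ∀ i, x i * x i = 0) :
    ∑ s, c s * mon (snoc x (x (Fin.last n).castSucc * x (Fin.last (n + 1)))) s =
      ∑ s, j₁Coeff c s * mon x s := by
  have hy := hx (Fin.last n).castSucc
  have hz := hx (Fin.last (n + 1))
  simp only [sum_snoc, mon_snoc, j₁Coeff, Fin.snoc_castSucc, Fin.snoc_last]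
  refine Finset.sum_congr rfl fun s _ => ?_
  generalize mon (A := A) _ s = u
  generalize x (Fin.last n).castSucc = y at *
  generalize x (Fin.last (n + 1)) = z at *
  simp only [Bool.false_eq_true, if_false, if_true, and_false, and_true]
  linear_combination (c (snoc (snoc (snoc s false) true) true) * u * y +
    c (snoc (snoc (snoc s true) true) true) * u * y * y) * hz +
    c (snoc (snoc (snoc s true) false) true) * u * z * hy

lemma sum_mon_j₂ (c : (Fin (n + 3) → Bool) → A) (x : Fin (n + 2) → A) :
    ∑ s, c s * mon (snoc x 0) s = ∑ s, c (snoc s false) * mon x s := by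
  rw [sum_snoc]
  simp [mon_snoc]

lemma sum_mon_e (c : (Fin (n + 3) → Bool) → A) (x : Fin (n + 1) → A) :
    ∑ s, c s * mon (snoc (snoc (snoc (fun i => x i.castSucc) 0) 0) (x (Fin.last n))) s =
      ∑ s, eCoeff c s * mon x s := by
  simp [sum_snoc, mon_snoc, eCoeff]

end Monomials

section Expansion

variable {C : Type u} [Category.{v} C] [CartesianMonoidalCategory C] [BraidedCategory C]
  {k : Type w} [CommRing k] {R : C} [CommRingObj R] [AlgebraObj k R]

theorem KockLawvere.bijective (hR : KockLawvere k R) {W : Type w} [CommRing W] [Algebra k W]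
    (hW : IsWeilAlgebra k W) {S : C} {x : W →ₐ[k] (S ⟶ R)} (hx : IsSpec k R x)
    {Q : Type*} [Fintype Q] [DecidableEq Q] (c : W ≃ₗ[k] (Q → k)) (X : C) :
    Function.Bijective fun a : Q → (X ⟶ R) =>
      ∑ q, (snd S X ≫ a q) * (fst S X ≫ x (c.symm (Pi.single q 1))) := by
  let b : Module.Basis Q (X ⟶ R) ((X ⟶ R) ⊗[k] W) := (Module.Basis.ofEquivFun c).baseChange _
  convert (hR W hW S x hx X).comp b.equivFun.symm.bijective using 1
  ext1 a
  simp only [Function.comp, Module.Basis.equivFun_symm_apply, map_sum]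
  refine Finset.sum_congr rfl fun q _ => ?_
  rw [Module.Basis.baseChange_apply, TensorProduct.smul_tmul', smul_eq_mul, mul_one,
    Algebra.TensorProduct.productMap_apply_tmul, Module.Basis.coe_ofEquivFun]
  rfl

variable [HasFiniteLimits C] {n : ℕ} {p : Finset (Fin n × Fin n)}

lemma D_hom_ext {Y : C} {f g : Y ⟶ D R n p} (h : ∀ i, f ≫ coord i = g ≫ coord i) : f = g := by
  refine equalizer.hom_ext (Pi.hom_ext _ _ fun i => ?_)
  exact (Category.assoc _ _ _).trans ((h i).trans (Category.assoc _ _ _).symm)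

namespace SimplicialAlg

variable (k) in
/-- The functions on `D ^ n {p}` given by elements of its Weil algebra. -/
noncomputable def toHom : SimplicialAlg k p →ₐ[k] (D R n p ⟶ R) :=
  eval k p coord coord_mul_self fun _ h => coord_mul_coord (Or.inr h)

lemma toHom_X (i : Fin n) : toHom k (X k p i) = (coord i : D R n p ⟶ R) := eval_X _ _ _ _ _ _

theorem isSpec : IsSpec k R (toHom k (R := R) (p := p)) := by
  intro Y φ
  refine ⟨mk (fun i => φ (X k p i))
    (fun i => by rw [← map_mul, X_mul_X k p (Or.inl rfl), map_zero])
    (fun ij h => by rw [← map_mul, X_mul_X k p (Or.inr h), map_zero]), ?_, ?_⟩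
  · refine algHom_ext fun i => ?_
    rw [AlgHom.comp_apply, toHom_X, precomp_apply, mk_coord]
  · rintro f rfl
    refine D_hom_ext fun i => ?_
    rw [mk_coord, AlgHom.comp_apply, toHom_X, precomp_apply]

end SimplicialAlg

variable (k R p) in
theorem isSmall_D : IsSmall k R (D R n p) :=
  ⟨SimplicialAlg k p, _, _, SimplicialAlg.isWeilAlgebra k p, _, SimplicialAlg.isSpec⟩

/-- The function `∑ aₛ xₛ` on `D ^ n {p}` at stage `X`, where `xₛ` is the squarefree monomial with
support `s`. -/
noncomputable def expand (p : Finset (Fin n × Fin n)) {X : C} (a : (Fin n → Bool) → (X ⟶ R)) :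
    D R n p ⊗ X ⟶ R :=
  ∑ s, (snd _ X ≫ a s) * mon (fun i => fst _ X ≫ coord i) s

lemma expand_eq_sum_indep [Fintype {s // Indep p s}] {X : C} (a : (Fin n → Bool) → (X ⟶ R)) :
    expand p a =
      ∑ s : {s // Indep p s}, (snd _ X ≫ a s) * mon (fun i => fst _ X ≫ coord i) s.1 := by
  classical
  rw [expand, ← Finset.sum_subtype (Finset.univ.filter (Indep p)) (by simp)
    (fun s => (snd _ X ≫ a s) * mon (fun i => fst _ X ≫ coord i) s), Finset.sum_filter_of_ne]
  intro s _ hs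
  by_contra hi
  simp only [Indep, not_forall, not_not] at hi
  obtain ⟨ij, hij, hne, hi, hj⟩ := hi
  refine hs ?_
  rw [mon_eq_zero hne hi hj ?_, mul_zero]
  rw [← MonObj.comp_mul, coord_mul_coord (Or.inr hij), AddMonObj.comp_zero]

lemma sum_indep_bijective (hR : KockLawvere k R) [Fintype {s // Indep p s}] (X : C) :
    Function.Bijective fun a : {s // Indep p s} → (X ⟶ R) =>
      ∑ s, (snd (D R n p) X ≫ a s) * mon (fun i => fst _ X ≫ coord i) s.1 := by
  classical
  convert hR.bijective (SimplicialAlg.isWeilAlgebra k p) SimplicialAlg.isSpec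
    (SimplicialAlg.coeffEquiv k p) X using 4 with a s
  rw [SimplicialAlg.coeffEquiv_symm_single, ← precomp_apply (k := k), map_mon, map_mon]
  simp only [SimplicialAlg.toHom_X]
  rfl

theorem exists_expand (hR : KockLawvere k R) {X : C} (φ : D R n p ⊗ X ⟶ R) :
    ∃ a, expand p a = φ := by
  classical
  obtain ⟨a, rfl⟩ := (sum_indep_bijective hR X).2 φ
  refine ⟨fun s => if h : Indep p s then a ⟨s, h⟩ else 0, ?_⟩
  rw [expand_eq_sum_indep]
  exact Finset.sum_congr rfl fun s _ => by rw [dif_pos s.2]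

theorem expand_eq_iff (hR : KockLawvere k R) {X : C} {a b : (Fin n → Bool) → (X ⟶ R)} :
    expand p a = expand p b ↔ ∀ s, Indep p s → a s = b s := by
  classical
  rw [expand_eq_sum_indep, expand_eq_sum_indep]
  refine ⟨fun h s hs => ?_, fun h => ?_⟩
  · exact congrFun ((sum_indep_bijective hR X).1 (a₁ := fun s => a s.1) (a₂ := fun s => b s.1) h)
      ⟨s, hs⟩
  · exact Finset.sum_congr rfl fun s _ => by rw [h s.1 s.2]

theorem expand_empty_injective (hR : KockLawvere k R) {X : C} {a b : (Fin n → Bool) → (X ⟶ R)}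
    (h : expand ∅ a = expand ∅ b) : a = b :=
  funext fun s => (expand_eq_iff hR).1 h s (indep_empty s)

end Expansion

section Restriction

variable {C : Type u} [Category.{v} C] [CartesianMonoidalCategory C] [BraidedCategory C]
  {R : C} [CommRingObj R]

/-- Change of stage, as a homomorphism of rings. -/
def compHom {X Y : C} (f : X ⟶ Y) : (Y ⟶ R) →+* (X ⟶ R) where
  toFun r := f ≫ r
  map_one' := MonObj.comp_one f
  map_mul' := MonObj.comp_mul f
  map_zero' := AddMonObj.comp_zero f
  map_add' := AddMonObj.comp_add f

lemma compHom_apply {X Y : C} (f : X ⟶ Y) (r : Y ⟶ R) : compHom f r = f ≫ r := rfl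

variable [HasFiniteLimits C] {n : ℕ} {p : Finset (Fin n × Fin n)} {X : C}

lemma whiskerRight_expand {S : C} (f : S ⟶ D R n p) (a : (Fin n → Bool) → (X ⟶ R)) :
    f ▷ X ≫ expand p a = ∑ s, (snd _ X ≫ a s) * mon (fun i => fst _ X ≫ f ≫ coord i) s := by
  rw [← compHom_apply, expand, map_sum]
  refine Finset.sum_congr rfl fun s _ => ?_
  rw [map_mul, map_mon]
  simp only [compHom_apply, whiskerRight_snd_assoc, whiskerRight_fst_assoc]

lemma incl_expand (a : (Fin n → Bool) → (X ⟶ R)) :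
    incl p ▷ X ≫ expand ∅ a = expand p a := by
  rw [whiskerRight_expand]
  simp only [incl, mk_coord, expand]

lemma permute_expand (σ : Equiv.Perm (Fin n)) (a : (Fin n → Bool) → (X ⟶ R)) :
    permute σ ▷ X ≫ expand ∅ a = expand ∅ fun s => a (s ∘ ⇑σ⁻¹) := by
  rw [whiskerRight_expand]
  simp only [permute, mk_coord, expand]
  rw [← (Equiv.arrowCongr σ (Equiv.refl Bool)).sum_comp]
  refine Finset.sum_congr rfl fun s _ => ?_
  congr 1
  exact Fintype.prod_equiv σ⁻¹ _ _ fun i => rfl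

lemma j₁_coord (i : Fin (n + 3)) : (j₁ n : D R (n + 2) ∅ ⟶ _) ≫ coord i =
    snoc coord (coord (Fin.last n).castSucc * coord (Fin.last (n + 1))) i :=
  mk_coord _ _ _ i

lemma j₂_coord (i : Fin (n + 3)) :
    (j₂ n : D R (n + 2) ∅ ⟶ _) ≫ coord i = snoc (A := _ ⟶ R) coord 0 i :=
  mk_coord _ _ _ i

lemma e_coord (i : Fin (n + 3)) : (e n : D R (n + 1) ∅ ⟶ _) ≫ coord i =
    snoc (snoc (snoc (A := _ ⟶ R) (fun i => coord i.castSucc) 0) 0) (coord (Fin.last n)) i :=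
  mk_coord _ _ _ i

lemma j₁_expand (c : (Fin (n + 3) → Bool) → (X ⟶ R)) :
    j₁ n ▷ X ≫ expand (rel n) c = expand ∅ (j₁Coeff c) := by
  rw [whiskerRight_expand]
  have := sum_mon_j₁ (fun s => snd (D R (n + 2) ∅) X ≫ c s) (fun i => fst _ X ≫ coord i)
    (fun i => by rw [← MonObj.comp_mul, coord_mul_self, AddMonObj.comp_zero])
  simp only [j₁_coord, expand]
  convert this using 5 with s _ i s _
  · refine Fin.lastCases ?_ (fun i => ?_) i <;> simp [MonObj.comp_mul]
  · simp only [j₁Coeff, AddMonObj.comp_add]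
    split_ifs <;> simp [AddMonObj.comp_zero]

lemma j₂_expand (c : (Fin (n + 3) → Bool) → (X ⟶ R)) :
    j₂ n ▷ X ≫ expand (rel n) c = expand ∅ fun s => c (snoc s false) := by
  rw [whiskerRight_expand]
  have := sum_mon_j₂ (fun s => snd (D R (n + 2) ∅) X ≫ c s) (fun i => fst _ X ≫ coord i)
  simp only [j₂_coord, expand]
  convert this using 5 with s _ i
  refine Fin.lastCases ?_ (fun i => ?_) i <;> simp [AddMonObj.comp_zero]

lemma e_expand (c : (Fin (n + 3) → Bool) → (X ⟶ R)) :
    e n ▷ X ≫ expand (rel n) c = expand ∅ (eCoeff c) := by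
  rw [whiskerRight_expand]
  have := sum_mon_e (fun s => snd (D R (n + 1) ∅) X ≫ c s) (fun i => fst _ X ≫ coord i)
  simp only [e_coord, expand]
  convert this using 5 with s _ i
  · refine Fin.lastCases ?_ (fun i => ?_) i
    · simp
    · refine Fin.lastCases ?_ (fun i => ?_) i
      · simp [AddMonObj.comp_zero]
      · refine Fin.lastCases ?_ (fun i => ?_) i <;> simp [AddMonObj.comp_zero]
  · rfl

lemma snoc_snoc (s : Fin 0 → Bool) (a b : Bool) : snoc (snoc s a) b = ![a, b] := by
  ext i
  fin_cases i <;> rfl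

lemma sum_fin_one {A : Type*} [AddCommMonoid A] (f : (Fin 1 → Bool) → A) :
    ∑ s, f s = f ![false] + f ![true] := by
  have h (s : Fin 0 → Bool) (b : Bool) : snoc s b = ![b] := by ext i; fin_cases i; rfl
  simp only [sum_snoc, h, Finset.univ_unique, Finset.sum_singleton]

lemma sum_fin_two {A : Type*} [AddCommMonoid A] (f : (Fin 2 → Bool) → A) :
    ∑ s, f s = f ![false, false] + f ![false, true] + (f ![true, false] + f ![true, true]) := by
  simp only [sum_snoc, snoc_snoc, Finset.univ_unique, Finset.sum_singleton]

lemma i₁_expand (c : (Fin 2 → Bool) → (X ⟶ R)) :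
    i₁ ▷ X ≫ expand {(0, 1)} c = expand ∅ fun t => c ![t 0, false] := by
  rw [whiskerRight_expand, expand, sum_fin_two, sum_fin_one]
  simp [i₁, mon, AddMonObj.comp_zero]

lemma i₂_expand (c : (Fin 2 → Bool) → (X ⟶ R)) :
    i₂ ▷ X ≫ expand {(0, 1)} c = expand ∅ fun t => c ![false, t 0] := by
  rw [whiskerRight_expand, expand, sum_fin_two, sum_fin_one]
  simp [i₂, mon, AddMonObj.comp_zero]

lemma diag_expand (c : (Fin 2 → Bool) → (X ⟶ R)) :
    diag ▷ X ≫ expand {(0, 1)} c = expand ∅ fun t =>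
      if t 0 then c ![true, false] + c ![false, true] else c ![false, false] := by
  have h : (fst (D R 1 ∅) X ≫ coord 0) * (fst (D R 1 ∅) X ≫ coord 0) = (0 : _ ⟶ R) := by
    rw [← MonObj.comp_mul, coord_mul_self, AddMonObj.comp_zero]
  rw [whiskerRight_expand, expand, sum_fin_two, sum_fin_one]
  simp [diag, mon, AddMonObj.comp_add, h]
  ring

end Restriction

section InfinitesimalPushouts

variable {C : Type u} [Category.{v} C] [CartesianMonoidalCategory C] [BraidedCategory C]
  [HasFiniteLimits C] {R : C} [CommRingObj R] {n : ℕ} {X : C}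

lemma incl_expand_eq_iff {k : Type w} [CommRing k] [AlgebraObj k R] (hR : KockLawvere k R)
    {i j : Fin n} (hij : i ≠ j) {a b : (Fin n → Bool) → (X ⟶ R)} :
    incl {(i, j)} ▷ X ≫ expand ∅ a = incl {(i, j)} ▷ X ≫ expand ∅ b ↔
      ∀ s, ¬(s i = true ∧ s j = true) → a s = b s := by
  simp only [incl_expand, expand_eq_iff hR, indep_singleton hij]

lemma incl_j₁ (n : ℕ) :
    incl {((Fin.last n).castSucc, Fin.last (n + 1))} ≫ (j₁ n : _ ⟶ D R (n + 3) (rel n)) =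
      incl {((Fin.last n).castSucc, Fin.last (n + 1))} ≫ j₂ n := by
  refine D_hom_ext fun i => ?_
  rw [Category.assoc, Category.assoc, j₁_coord, j₂_coord]
  refine Fin.lastCases ?_ (fun i => ?_) i
  · simp only [Fin.snoc_last, MonObj.comp_mul, AddMonObj.comp_zero, incl, mk_coord]
    exact coord_mul_coord (by simp)
  · simp only [Fin.snoc_castSucc]

theorem strongDiff_ext {k : Type w} [CommRing k] [AlgebraObj k R] (hR : KockLawvere k R)
    {ν ν' : D R (n + 3) (rel n) ⊗ X ⟶ R}
    (h₁ : j₁ n ▷ X ≫ ν = j₁ n ▷ X ≫ ν') (h₂ : j₂ n ▷ X ≫ ν = j₂ n ▷ X ≫ ν') : ν = ν' := by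
  obtain ⟨c, rfl⟩ := exists_expand hR ν
  obtain ⟨c', rfl⟩ := exists_expand hR ν'
  rw [j₁_expand, j₁_expand] at h₁
  rw [j₂_expand, j₂_expand] at h₂
  replace h₁ := congrFun (expand_empty_injective hR h₁)
  replace h₂ := congrFun (expand_empty_injective hR h₂)
  refine (expand_eq_iff hR).2 fun s hs => ?_
  obtain ⟨s, b, rfl⟩ := exists_snoc s
  cases b
  · exact h₂ s
  · obtain ⟨s, b₂, rfl⟩ := exists_snoc s
    obtain ⟨s, b₁, rfl⟩ := exists_snoc s
    have hb₁ := hs ((Fin.last n).castSucc.castSucc, Fin.last (n + 2)) (by simp [rel])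
      (Fin.castSucc_lt_last _).ne
    have hb₂ := hs ((Fin.last (n + 1)).castSucc, Fin.last (n + 2)) (by simp [rel])
      (Fin.castSucc_lt_last _).ne
    simp only [Fin.snoc_castSucc, Fin.snoc_last, and_true, Bool.not_eq_true] at hb₁ hb₂
    subst hb₁ hb₂
    have h := h₁ (snoc (snoc s true) true)
    rw [j₁Coeff, j₁Coeff, h₂] at h
    simpa using h

/-- The coefficients of the strong difference of two functions with coefficients `a` and `b`. -/
def sdCoeff {A : Type*} [Sub A] (a b : (Fin (n + 2) → Bool) → A) (t : Fin (n + 1) → Bool) : A :=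
  if t (Fin.last n) then a (snoc t true) - b (snoc t true) else b (snoc t false)

theorem exists_strongDiff {a b : (Fin (n + 2) → Bool) → (X ⟶ R)}
    (h : ∀ s, ¬(s (Fin.last n).castSucc = true ∧ s (Fin.last (n + 1)) = true) → a s = b s) :
    ∃ ν : D R (n + 3) (rel n) ⊗ X ⟶ R, j₁ n ▷ X ≫ ν = expand ∅ a ∧ j₂ n ▷ X ≫ ν = expand ∅ b ∧
      e n ▷ X ≫ ν = expand ∅ (sdCoeff a b) := by
  let c (s : Fin (n + 3) → Bool) : X ⟶ R :=
    if s (Fin.last (n + 2)) then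
      a (snoc (snoc (fun i => s i.castSucc.castSucc.castSucc) true) true) -
        b (snoc (snoc (fun i => s i.castSucc.castSucc.castSucc) true) true)
    else b fun i => s i.castSucc
  refine ⟨expand _ c, ?_, ?_, ?_⟩
  · rw [j₁_expand]
    congr 1
    ext1 s
    obtain ⟨s, b₂, rfl⟩ := exists_snoc s
    obtain ⟨s, b₁, rfl⟩ := exists_snoc s
    by_cases hb : b₁ = true ∧ b₂ = true
    · simp [j₁Coeff, c, hb.1, hb.2]
    · rw [h _ (by simpa using hb)]
      simp only [j₁Coeff, c, Fin.snoc_castSucc, Fin.snoc_last]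
      simp [hb]
  · rw [j₂_expand]
    simp [c]
  · rw [e_expand]
    congr 1
    ext1 t
    obtain ⟨t, b₁, rfl⟩ := exists_snoc t
    cases b₁ <;> simp [eCoeff, c, sdCoeff]

variable (R) in
/-- The inclusion of the origin. -/
noncomputable def origin (n : ℕ) : D R 0 ∅ ⟶ D R n ∅ := mk (fun _ => 0) (by simp) (by simp)

lemma origin_i₁ : origin R 1 ≫ i₁ = origin R 1 ≫ i₂ := by
  refine D_hom_ext fun i => ?_
  rw [Category.assoc, Category.assoc, i₁, i₂, mk_coord, mk_coord]
  fin_cases i <;> simp [origin, AddMonObj.comp_zero]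

/-- The coefficients of a tangent vector with value `c` at the origin and slope `v`. -/
def tangentCoeff {A : Type*} (c v : A) (t : Fin 1 → Bool) : A := if t 0 then v else c

lemma eq_tangentCoeff {A : Type*} (a : (Fin 1 → Bool) → A) :
    a = tangentCoeff (a fun _ => false) (a fun _ => true) := by
  ext t
  obtain ⟨b, rfl⟩ : ∃ b, t = fun _ => b := ⟨t 0, funext fun i => by rw [Subsingleton.elim i 0]⟩
  cases b <;> rfl

lemma origin_expand (c v : X ⟶ R) :
    origin R 1 ▷ X ≫ expand ∅ (tangentCoeff c v) = expand ∅ fun _ => c := by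
  rw [whiskerRight_expand, expand, sum_fin_one]
  simp [origin, mon, AddMonObj.comp_zero, tangentCoeff]

theorem tangentAdd_ext {k : Type w} [CommRing k] [AlgebraObj k R] (hR : KockLawvere k R)
    {ν ν' : D R 2 {(0, 1)} ⊗ X ⟶ R}
    (h₁ : i₁ ▷ X ≫ ν = i₁ ▷ X ≫ ν') (h₂ : i₂ ▷ X ≫ ν = i₂ ▷ X ≫ ν') : ν = ν' := by
  obtain ⟨c, rfl⟩ := exists_expand hR ν
  obtain ⟨c', rfl⟩ := exists_expand hR ν'
  rw [i₁_expand, i₁_expand] at h₁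
  rw [i₂_expand, i₂_expand] at h₂
  refine (expand_eq_iff hR).2 fun s hs => ?_
  rw [indep_singleton (by decide)] at hs
  obtain ⟨a, b, rfl⟩ : ∃ a b, s = ![a, b] := ⟨s 0, s 1, by ext i; fin_cases i <;> rfl⟩
  cases b
  · exact congrFun (expand_empty_injective hR h₁) fun _ => a
  · obtain rfl : a = false := by simpa using hs
    exact congrFun (expand_empty_injective hR h₂) fun _ => true

theorem exists_tangentAdd (c v₁ v₂ : X ⟶ R) :
    ∃ ν : D R 2 {(0, 1)} ⊗ X ⟶ R, i₁ ▷ X ≫ ν = expand ∅ (tangentCoeff c v₁) ∧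
      i₂ ▷ X ≫ ν = expand ∅ (tangentCoeff c v₂) ∧
      diag ▷ X ≫ ν = expand ∅ (tangentCoeff c (v₁ + v₂)) := by
  refine ⟨expand _ fun s => if s 1 then v₂ else if s 0 then v₁ else c, ?_, ?_, ?_⟩
  · rw [i₁_expand]
    rfl
  · rw [i₂_expand]
    rfl
  · rw [diag_expand]
    rfl

variable [MonoidalClosed C] {k : Type w} [CommRing k] [AlgebraObj k R]

theorem isQuasiPushout_strongDiff (hR : KockLawvere k R) (n : ℕ) :
    IsQuasiPushout k R (incl (R := R) {((Fin.last n).castSucc, Fin.last (n + 1))}) (incl _)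
      (j₁ n) (j₂ n) where
  w := incl_j₁ n
  isSmall_source := isSmall_D k R _
  isSmall_left := isSmall_D k R _
  isSmall_right := isSmall_D k R _
  isSmall_target := isSmall_D k R _
  perceives := by
    refine (perceives_pushoutCocone_iff R (incl_j₁ n)).2 fun X φ₁ φ₂ h => ?_
    obtain ⟨a, rfl⟩ := exists_expand hR φ₁
    obtain ⟨b, rfl⟩ := exists_expand hR φ₂
    obtain ⟨ν, h₁, h₂, -⟩ :=
      exists_strongDiff ((incl_expand_eq_iff hR (Fin.castSucc_lt_last _).ne).1 h)
    exact ⟨ν, ⟨h₁, h₂⟩, fun ν' h' => strongDiff_ext hR (h'.1.trans h₁.symm) (h'.2.trans h₂.symm)⟩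

theorem isQuasiPushout_tangentAdd (hR : KockLawvere k R) :
    IsQuasiPushout k R (origin R 1) (origin R 1) i₁ i₂ where
  w := origin_i₁
  isSmall_source := isSmall_D k R _
  isSmall_left := isSmall_D k R _
  isSmall_right := isSmall_D k R _
  isSmall_target := isSmall_D k R _
  perceives := by
    refine (perceives_pushoutCocone_iff R origin_i₁).2 fun X φ₁ φ₂ h => ?_
    obtain ⟨a, rfl⟩ := exists_expand hR φ₁
    obtain ⟨b, rfl⟩ := exists_expand hR φ₂
    obtain ⟨c, v₁, rfl⟩ : ∃ c v, a = tangentCoeff c v := ⟨_, _, eq_tangentCoeff a⟩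
    obtain ⟨c', v₂, rfl⟩ : ∃ c v, b = tangentCoeff c v := ⟨_, _, eq_tangentCoeff b⟩
    rw [origin_expand, origin_expand] at h
    obtain rfl : c = c' := congrFun (expand_empty_injective hR h) fun _ => false
    obtain ⟨ν, h₁, h₂, -⟩ := exists_tangentAdd c v₁ v₂
    exact ⟨ν, ⟨h₁, h₂⟩, fun ν' h' => tangentAdd_ext hR (h'.1.trans h₁.symm) (h'.2.trans h₂.symm)⟩

end InfinitesimalPushouts

section Spec

section StructureConstants

variable {k : Type w} [CommRing k] {W : Type*} [CommRing W] [Algebra k W] {Q : Type*} [Fintype Q]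
  {A : Type*} [Semiring A] [Algebra k A]

/-- The family `y` satisfies the equations `1 = ∑ c_q y_q` and `y_p y_q = ∑ c_{pqr} y_r` given by
the structure constants of `W` with respect to the basis `b`; such families correspond to
homomorphisms from `W`. -/
def SolvesStructure (b : Module.Basis Q k W) (y : Q → A) : Prop :=
  ∑ q, b.repr 1 q • y q = 1 ∧ ∀ p q, ∑ r, b.repr (b p * b q) r • y r = y p * y q

lemma solvesStructure_algHom (b : Module.Basis Q k W) (φ : W →ₐ[k] A) :
    SolvesStructure b fun q => φ (b q) := by
  have h (a : W) : ∑ q, b.repr a q • φ (b q) = φ a := by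
    simp only [← map_smul, ← map_sum, b.sum_repr]
  exact ⟨(h 1).trans (map_one φ), fun p q => (h _).trans (map_mul φ _ _)⟩

lemma SolvesStructure.exists_algHom {b : Module.Basis Q k W} {y : Q → A}
    (hy : SolvesStructure b y) : ∃ φ : W →ₐ[k] A, ∀ q, φ (b q) = y q := by
  let f : W →ₗ[k] A := b.constr k y
  have hf (a : W) : f a = ∑ q, b.repr a q • y q := b.constr_apply_fintype k y a
  have hb (q : Q) : f (b q) = y q := b.constr_basis k y q
  have hmul : (LinearMap.mul k W).compr₂ f = (LinearMap.mul k A).compl₁₂ f f :=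
    b.ext fun p => b.ext fun q => by simp [hf (b p * b q), hy.2, hb]
  exact ⟨AlgHom.ofLinearMap f ((hf 1).trans hy.1) (LinearMap.congr_fun₂ hmul), hb⟩

end StructureConstants

variable {C : Type u} [Category.{v} C] [CartesianMonoidalCategory C] [BraidedCategory C]
  {k : Type w} [CommRing k] {R : C} [CommRingObj R] [AlgebraObj k R]

lemma comp_smul {X Y : C} (f : X ⟶ Y) (r : k) (g : Y ⟶ R) : f ≫ (r • g) = r • (f ≫ g) :=
  map_smul (precomp k R f) r g

lemma comp_sum {X Y : C} {ι : Type*} (f : X ⟶ Y) (s : Finset ι) (g : ι → (Y ⟶ R)) :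
    f ≫ (∑ i ∈ s, g i) = ∑ i ∈ s, f ≫ g i :=
  map_sum (compHom f) g s

variable {W : Type w} [CommRing W] [Algebra k W] {Q : Type}

variable (R) in
lemma exists_universal_solution [HasFiniteLimits C] [Fintype Q] (b : Module.Basis Q k W) :
    ∃ (G : C) (y : Q → (G ⟶ R)), SolvesStructure b y ∧
      ∀ (Y : C) (z : Q → (Y ⟶ R)), SolvesStructure b z → ∃! f : Y ⟶ G, ∀ q, f ≫ y q = z q := by
  let π (q : Q) : (∏ᶜ fun _ : Q => R) ⟶ R := Pi.π (fun _ : Q => R) q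
  let l : (∏ᶜ fun _ : Q => R) ⟶ ∏ᶜ fun _ : Option (Q × Q) => R :=
    Pi.lift fun o => ∑ r, b.repr (o.elim 1 fun pq => b pq.1 * b pq.2) r • π r
  let r : (∏ᶜ fun _ : Q => R) ⟶ ∏ᶜ fun _ : Option (Q × Q) => R :=
    Pi.lift fun o => o.elim 1 fun pq => π pq.1 * π pq.2
  have hlr {Y : C} (f : Y ⟶ ∏ᶜ fun _ : Q => R) :
      f ≫ l = f ≫ r ↔ SolvesStructure b fun q => f ≫ π q := by
    rw [Pi.hom_ext_iff]
    simp only [l, r, Category.assoc, limit.lift_π, Fan.mk_π_app, Option.forall, Prod.forall,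
      Option.elim_none, Option.elim_some, comp_sum, comp_smul, MonObj.comp_one, MonObj.comp_mul,
      SolvesStructure]
  refine ⟨equalizer l r, fun q => equalizer.ι l r ≫ π q, (hlr _).1 (equalizer.condition l r),
    fun Y z hz => ?_⟩
  have hπ (q : Q) : Pi.lift z ≫ π q = z q := by
    simp only [π, limit.lift_π, Fan.mk_π_app]
  refine ⟨equalizer.lift (Pi.lift z) ((hlr _).2 (by simpa only [hπ] using hz)), fun q => ?_,
    fun f hf => equalizer.hom_ext (Pi.hom_ext _ _ fun q => ?_)⟩
  · rw [equalizer.lift_ι_assoc, hπ]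
  · rw [equalizer.lift_ι, Category.assoc]
    exact (hf q).trans (hπ q).symm

variable (R) in
theorem exists_isSpec [HasFiniteLimits C] [Finite Q] (b : Module.Basis Q k W) :
    ∃ (G : C) (x : W →ₐ[k] (G ⟶ R)), IsSpec k R x := by
  have := Fintype.ofFinite Q
  obtain ⟨G, y, hy, huniv⟩ := exists_universal_solution R b
  obtain ⟨x, hx⟩ := hy.exists_algHom
  refine ⟨G, x, fun Y φ => ?_⟩
  have hcomp (f : Y ⟶ G) : (precomp k R f).comp x = φ ↔ ∀ q, f ≫ y q = φ (b q) := by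
    simp only [← hx]
    exact ⟨fun h q => DFunLike.congr_fun h (b q),
      fun h => AlgHom.toLinearMap_injective (b.ext h)⟩
  simpa only [hcomp] using huniv Y _ (solvesStructure_algHom b φ)

end Spec

section Coefficients

variable (k : Type w) [CommRing k] {n : ℕ}

namespace SimplicialAlg

/-- Restriction of functions from `D ^ n` to `D ^ n {p}`. -/
noncomputable def restrict (p : Finset (Fin n × Fin n)) :
    SimplicialAlg k (∅ : Finset (Fin n × Fin n)) →ₐ[k] SimplicialAlg k p :=
  eval k ∅ (X k p) (fun _ => X_mul_X k p (Or.inl rfl)) (by simp)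

lemma restrict_mk (p : Finset (Fin n × Fin n)) (f : MvPolynomial (Fin n) k) :
    restrict k p (Ideal.Quotient.mk _ f) = Ideal.Quotient.mk _ f := by
  change MvPolynomial.aeval (X k p) f = Ideal.Quotient.mkₐ k _ f
  congr 1
  exact MvPolynomial.algHom_ext fun i => MvPolynomial.aeval_X _ _

/-- The coefficient of the squarefree monomial with support `s` in a function on `D ^ n`. -/
noncomputable def coeff (s : Fin n → Bool) :
    SimplicialAlg k (∅ : Finset (Fin n × Fin n)) →ₗ[k] k :=
  (LinearMap.proj ⟨s, indep_empty s⟩).comp (coeffEquiv k ∅).toLinearMap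

lemma coeffEquiv_restrict (p : Finset (Fin n × Fin n))
    (a : SimplicialAlg k (∅ : Finset (Fin n × Fin n))) (s : {s // Indep p s}) :
    coeffEquiv k p (restrict k p a) s = coeff k s.1 a := by
  obtain ⟨f, rfl⟩ := Ideal.Quotient.mk_surjective a
  rw [restrict_mk]
  rfl

lemma restrict_eq_iff (p : Finset (Fin n × Fin n))
    (a b : SimplicialAlg k (∅ : Finset (Fin n × Fin n))) :
    restrict k p a = restrict k p b ↔ ∀ s, Indep p s → coeff k s a = coeff k s b := by
  rw [← (coeffEquiv k p).injective.eq_iff, funext_iff]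
  simp only [coeffEquiv_restrict, Subtype.forall]

/-- The function on `D ^ n` with given coefficients. -/
noncomputable def ofCoeff (a : (Fin n → Bool) → k) :
    SimplicialAlg k (∅ : Finset (Fin n × Fin n)) :=
  (coeffEquiv k ∅).symm fun s => a s

lemma coeff_ofCoeff (a : (Fin n → Bool) → k) (s : Fin n → Bool) :
    coeff k s (ofCoeff k a) = a s := by
  simp [coeff, ofCoeff]

lemma ofCoeff_coeff (a : SimplicialAlg k (∅ : Finset (Fin n × Fin n))) :
    (ofCoeff k fun s => coeff k s a) = a :=
  (coeffEquiv k ∅).symm_apply_apply a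

lemma ofCoeff_eq_sum (a : (Fin n → Bool) → k) : ofCoeff k a = ∑ s, a s • mon (X k ∅) s := by
  classical
  have hsum : ofCoeff k a = ∑ s : {s // Indep ∅ s}, a s • mon (X k ∅) s.1 := by
    simp only [← coeffEquiv_symm_single, ← map_smul, ← map_sum, ofCoeff]
    congr 1
    ext s
    simp [Pi.single_apply]
  rw [hsum]
  exact Fintype.sum_equiv (Equiv.subtypeUnivEquiv indep_empty) _ _ fun _ => rfl

end SimplicialAlg

variable {C : Type u} [Category.{v} C] [CartesianMonoidalCategory C] [BraidedCategory C]
  [HasFiniteLimits C] {R : C} [CommRingObj R] [AlgebraObj k R]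

lemma incl_toHom (p : Finset (Fin n × Fin n))
    (a : SimplicialAlg k (∅ : Finset (Fin n × Fin n))) :
    incl p ≫ (SimplicialAlg.toHom k a : _ ⟶ R) =
      SimplicialAlg.toHom k (SimplicialAlg.restrict k p a) := by
  have : (precomp k R (incl p)).comp (SimplicialAlg.toHom k) =
      (SimplicialAlg.toHom k).comp (SimplicialAlg.restrict k p) := by
    refine SimplicialAlg.algHom_ext fun i => ?_
    rw [AlgHom.comp_apply, AlgHom.comp_apply, SimplicialAlg.restrict, SimplicialAlg.eval_X,
      SimplicialAlg.toHom_X, SimplicialAlg.toHom_X, precomp_apply, incl, mk_coord]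
  exact DFunLike.congr_fun this a

lemma toHom_ofCoeff (a : (Fin n → Bool) → k) :
    (SimplicialAlg.toHom k (SimplicialAlg.ofCoeff k a) : _ ⟶ R) = ∑ s, a s • mon coord s := by
  rw [SimplicialAlg.ofCoeff_eq_sum, map_sum]
  refine Finset.sum_congr rfl fun s _ => ?_
  rw [map_smul, map_mon]
  simp only [SimplicialAlg.toHom_X]

end Coefficients

section Gluing

variable (k : Type w) [CommRing k] {n : ℕ} {J : MultispanShape.{0, 0}}
  (p : J.L → Finset (Fin n × Fin n))

/-- The Weil algebra of the colimit of copies of `D ^ n`, one for each `v : J.R`, in which the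
copies `J.fst a` and `J.snd a` are glued along `D ^ n {p a}`: the families of functions on `D ^ n`
which agree there. -/
def GluedAlg : Subalgebra k (J.R → SimplicialAlg k (∅ : Finset (Fin n × Fin n))) where
  carrier := {f | ∀ a, SimplicialAlg.restrict k (p a) (f (J.fst a)) =
    SimplicialAlg.restrict k (p a) (f (J.snd a))}
  mul_mem' hf hg a := by simp only [Pi.mul_apply, map_mul, hf a, hg a]
  add_mem' hf hg a := by simp only [Pi.add_apply, map_add, hf a, hg a]
  algebraMap_mem' r a := by simp only [Pi.algebraMap_apply]

/-- Two monomials on neighbouring copies of `D ^ n` have the same nonzero restriction. -/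
def GluedMon (x y : J.R × (Fin n → Bool)) : Prop :=
  ∃ a s, Indep (p a) s ∧ x = (J.fst a, s) ∧ y = (J.snd a, s)

/-- Two copies of `D ^ n` are glued along a subobject. -/
def Neighbours (J : MultispanShape.{0, 0}) (u v : J.R) : Prop :=
  ∃ a, J.fst a = u ∧ J.snd a = v

lemma eq_of_eqvGen_neighbours {A : Type*} {f : J.R → A} (hf : ∀ a, f (J.fst a) = f (J.snd a))
    {u v : J.R} (h : Relation.EqvGen (Neighbours J) u v) : f u = f v :=
  congrArg (Quot.lift f (by rintro _ _ ⟨a, rfl, rfl⟩; exact hf a)) (Quot.eqvGen_sound h)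

namespace GluedAlg

/-- The component at `v` of a compatible family. -/
noncomputable def component (v : J.R) :
    GluedAlg k p →ₐ[k] SimplicialAlg k (∅ : Finset (Fin n × Fin n)) :=
  (Pi.evalAlgHom k _ v).comp (GluedAlg k p).val

lemma restrict_component (f : GluedAlg k p) (a : J.L) :
    SimplicialAlg.restrict k (p a) (component k p (J.fst a) f) =
      SimplicialAlg.restrict k (p a) (component k p (J.snd a) f) :=
  f.2 a

lemma coeff_eq {x y : J.R × (Fin n → Bool)} (h : GluedMon p x y) (f : GluedAlg k p) :
    SimplicialAlg.coeff k x.2 (component k p x.1 f) =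
      SimplicialAlg.coeff k y.2 (component k p y.1 f) := by
  obtain ⟨a, s, hs, rfl, rfl⟩ := h
  exact (SimplicialAlg.restrict_eq_iff k _ _ _).1 (restrict_component k p f a) s hs

/-- The coordinates of a compatible family are its coefficients, which depend only on the class of
a monomial. -/
noncomputable def coords : GluedAlg k p ≃ₗ[k] (Quot (GluedMon p) → k) where
  toFun f := Quot.lift (fun x => SimplicialAlg.coeff k x.2 (component k p x.1 f))
    fun _ _ h => coeff_eq k p h f
  map_add' f g := by
    ext ⟨x⟩
    exact map_add _ _ _
  map_smul' r f := by
    ext ⟨x⟩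
    exact (SimplicialAlg.coeff k x.2).map_smul r (component k p x.1 f)
  invFun c := ⟨fun v => SimplicialAlg.ofCoeff k fun s => c (Quot.mk _ (v, s)), fun a => by
    rw [SimplicialAlg.restrict_eq_iff]
    intro s hs
    rw [SimplicialAlg.coeff_ofCoeff, SimplicialAlg.coeff_ofCoeff]
    exact congrArg c (Quot.sound ⟨a, s, hs, rfl, rfl⟩)⟩
  left_inv f := Subtype.ext (funext fun v => SimplicialAlg.ofCoeff_coeff k (f.1 v))
  right_inv c := by
    ext ⟨x⟩
    exact SimplicialAlg.coeff_ofCoeff k (fun s => c (Quot.mk _ (x.1, s))) x.2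

lemma component_coords_symm (c : Quot (GluedMon p) → k) (v : J.R) :
    component k p v ((coords k p).symm c) =
      SimplicialAlg.ofCoeff k fun s => c (Quot.mk _ (v, s)) := rfl

variable {p}

lemma isNilpotent [Finite J.R] {v₀ : J.R} (hJ : ∀ v, Relation.EqvGen (Neighbours J) v v₀)
    (f : GluedAlg k p) (hf : SimplicialAlg.eps k ∅ (component k p v₀ f) = 0) : IsNilpotent f := by
  have : Fintype J.R := Fintype.ofFinite _
  have hε (v : J.R) : SimplicialAlg.eps k ∅ (component k p v f) = 0 := by
    refine (eq_of_eqvGen_neighbours (f := fun v => SimplicialAlg.eps k ∅ (component k p v f))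
      (fun a => ?_) (hJ v)).trans hf
    rw [SimplicialAlg.eps_apply, SimplicialAlg.eps_apply]
    exact coeff_eq k p ⟨a, _, indep_const_false _, rfl, rfl⟩ f
  choose N hN using fun v => SimplicialAlg.isNilpotent_of_eps_eq_zero k ∅ (hε v)
  refine ⟨∑ v, N v, Subtype.ext (funext fun v => ?_)⟩
  exact pow_eq_zero_of_le
    (Finset.single_le_sum (fun _ _ => Nat.zero_le _) (Finset.mem_univ v)) (hN v)

theorem isWeilAlgebra [Finite J.R] {v₀ : J.R}
    (hJ : ∀ v, Relation.EqvGen (Neighbours J) v v₀) : IsWeilAlgebra k (GluedAlg k p) :=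
  isWeilAlgebra_of_coordinates (coords k p) (Quot.mk _ (v₀, fun _ => false))
    ((SimplicialAlg.eps k ∅).comp (component k p v₀))
    (fun f => SimplicialAlg.eps_apply k ∅ (component k p v₀ f)) (isNilpotent k hJ)

end GluedAlg

variable {k p}
variable {C : Type u} [Category.{v} C] [CartesianMonoidalCategory C] [BraidedCategory C]
  [HasFiniteLimits C] {R : C} [CommRingObj R] [AlgebraObj k R]
  {G : C} {x : GluedAlg k p →ₐ[k] (G ⟶ R)} {ι : J.R → (D R n ∅ ⟶ G)}

namespace GluedAlg

lemma incl_comp_eq (hx : IsSpec k R (W := GluedAlg k p) x)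
    (hι : ∀ v f, ι v ≫ x f = SimplicialAlg.toHom k (component k p v f)) (a : J.L) :
    incl (p a) ≫ ι (J.fst a) = incl (p a) ≫ ι (J.snd a) := hx.hom_ext fun f => by
  rw [Category.assoc, Category.assoc, hι, hι, incl_toHom, incl_toHom, restrict_component]

lemma whiskerRight_sum_coords [Fintype (Quot (GluedMon p))] [DecidableEq (Quot (GluedMon p))]
    {X : C} {v : J.R} {f : D R n ∅ ⟶ G}
    (hf : ∀ a, f ≫ x a = SimplicialAlg.toHom k (component k p v a))
    (b : Quot (GluedMon p) → (X ⟶ R)) :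
    f ▷ X ≫ (∑ q, (snd G X ≫ b q) * (fst G X ≫ x ((coords k p).symm (Pi.single q 1)))) =
      expand ∅ fun s => b (Quot.mk _ (v, s)) := by
  have hsummand (q : Quot (GluedMon p)) :
      f ▷ X ≫ ((snd G X ≫ b q) * (fst G X ≫ x ((coords k p).symm (Pi.single q 1)))) =
        ∑ s, if Quot.mk _ (v, s) = q then
          (snd _ X ≫ b q) * mon (fun i => fst _ X ≫ coord i) s else 0 := by
    rw [MonObj.comp_mul, whiskerRight_snd_assoc, whiskerRight_fst_assoc, hf,
      component_coords_symm, toHom_ofCoeff, comp_sum, Finset.mul_sum]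
    refine Finset.sum_congr rfl fun s _ => ?_
    rw [comp_smul, Pi.single_apply, ← compHom_apply (fst _ X), map_mon, ite_smul, one_smul,
      zero_smul, mul_ite, mul_zero]
    rfl
  rw [comp_sum, Finset.sum_congr rfl fun q _ => hsummand q, Finset.sum_comm]
  simp [expand]

theorem existsUnique_desc (hR : KockLawvere k R) [Finite J.R] {v₀ : J.R}
    (hJ : ∀ v, Relation.EqvGen (Neighbours J) v v₀) (hx : IsSpec k R (W := GluedAlg k p) x)
    (hι : ∀ v f, ι v ≫ x f = SimplicialAlg.toHom k (component k p v f)) {X : C}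
    {φ : J.R → (D R n ∅ ⊗ X ⟶ R)}
    (hφ : ∀ a, incl (p a) ▷ X ≫ φ (J.fst a) = incl (p a) ▷ X ≫ φ (J.snd a)) :
    ∃! ψ : G ⊗ X ⟶ R, ∀ v, ι v ▷ X ≫ ψ = φ v := by
  classical
  have : Fintype (Quot (GluedMon p)) := Fintype.ofFinite _
  choose a ha using fun v => exists_expand hR (φ v)
  obtain ⟨b, hb⟩ : ∃ b : Quot (GluedMon p) → (X ⟶ R), ∀ v s, b (Quot.mk _ (v, s)) = a v s := by
    refine ⟨Quot.lift (fun x => a x.1 x.2) ?_, fun _ _ => rfl⟩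
    rintro _ _ ⟨i, s, hs, rfl, rfl⟩
    have h := hφ i
    rw [← ha, ← ha, incl_expand, incl_expand, expand_eq_iff hR] at h
    exact h s hs
  refine ⟨∑ q, (snd G X ≫ b q) * (fst G X ≫ x ((coords k p).symm (Pi.single q 1))),
    fun v => ?_, fun ψ hψ => ?_⟩
  · rw [whiskerRight_sum_coords (hι v), ← ha]
    simp only [hb]
  · obtain ⟨b', rfl⟩ := (hR.bijective (isWeilAlgebra k hJ) hx (coords k p) X).2 ψ
    suffices b' = b by rw [this]
    ext ⟨v, s⟩
    have h := hψ v
    rw [whiskerRight_sum_coords (hι v), ← ha] at h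
    exact (congrFun (expand_empty_injective hR h) s).trans (hb v s).symm

end GluedAlg

theorem exists_universal_gluing [MonoidalClosed C] (hR : KockLawvere k R) [Finite J.L] [Finite J.R]
    {v₀ : J.R} (hJ : ∀ v, Relation.EqvGen (Neighbours J) v v₀) {M : C} (hM : Microlinear k R M)
    (p : J.L → Finset (Fin n × Fin n)) :
    ∃ (G : C) (x : GluedAlg k p →ₐ[k] (G ⟶ R)) (ι : J.R → (D R n ∅ ⟶ G)),
      IsSpec k R (W := GluedAlg k p) x ∧
      (∀ a, incl (p a) ≫ ι (J.fst a) = incl (p a) ≫ ι (J.snd a)) ∧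
      ∀ (X : C) (γ : J.R → Cube R X M n), (∀ a, AgreeOn (p a) (γ (J.fst a)) (γ (J.snd a))) →
        ∃ g : G ⊗ X ⟶ M, ∀ v, ι v ▷ X ≫ g = γ v := by
  classical
  have : Fintype (Quot (GluedMon p)) := Fintype.ofFinite _
  have : Fintype J.L := Fintype.ofFinite _
  have : Fintype J.R := Fintype.ofFinite _
  obtain ⟨G, x, hx⟩ := exists_isSpec (k := k) (W := GluedAlg k p) R
    (Module.Basis.ofEquivFun (GluedAlg.coords k p))
  choose ι hι using fun v =>
    (hx (D R n ∅) ((SimplicialAlg.toHom k).comp (GluedAlg.component k p v))).exists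
  replace hι (v f) := DFunLike.congr_fun (hι v) f
  let I : MultispanIndex J C :=
    ⟨fun a => D R n (p a), fun _ => D R n ∅, fun a => incl (p a), fun a => incl (p a)⟩
  have hincl := GluedAlg.incl_comp_eq hx hι
  refine ⟨G, x, ι, hx, hincl, fun X γ hγ => ?_⟩
  have hperceives : Perceives M (Multicofork.ofπ I G ι hincl) := by
    refine hM _ _ _ ?_ ⟨_, _, _, GluedAlg.isWeilAlgebra k hJ, x, hx⟩
      ((perceives_multicofork_iff R I G ι hincl).2 fun X φ hφ => ?_)
    · rintro (_ | _) <;> exact isSmall_D k R _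
    · exact GluedAlg.existsUnique_desc hR hJ hx hι hφ
  exact ((perceives_multicofork_iff M I G ι hincl).1 hperceives X γ hγ).exists

end Gluing

section Words

/-- Shape of the diagram gluing one copy of `D ^ (m + 1)` for each word in `m + 1` letters along a
subobject for each pair of words which differ by an interchange of neighbouring letters. -/
abbrev wordShape (m : ℕ) : MultispanShape.{0, 0} where
  L := Equiv.Perm (Fin (m + 1)) × Fin m
  R := Equiv.Perm (Fin (m + 1))
  fst a := a.1
  snd a := a.1 * Equiv.swap a.2.castSucc a.2.succ

/-- The relation `d_p d_q = 0` for the interchanged letters `p` and `q`. -/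
def wordRel {m : ℕ} (a : (wordShape m).L) : Finset (Fin (m + 1) × Fin (m + 1)) :=
  {(a.1 a.2.castSucc, a.1 a.2.succ)}

lemma eqvGen_neighbours_wordShape {m : ℕ} (τ : Equiv.Perm (Fin (m + 1))) :
    Relation.EqvGen (Neighbours (wordShape m)) τ 1 := by
  have hτ : τ ∈ Submonoid.closure
      (Set.range fun i : Fin m => Equiv.swap i.castSucc i.succ) := by
    rw [Equiv.Perm.mclosure_swap_castSucc_succ]
    exact Submonoid.mem_top τ
  induction hτ using Submonoid.closure_induction_right with
  | one => exact .refl _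
  | mul_right τ _ π hπ ih =>
    obtain ⟨i, rfl⟩ := hπ
    exact .trans _ _ _ (.symm _ _ (.rel _ _ ⟨(τ, i), rfl, rfl⟩)) ih

variable {A : Type*}

/-- The coefficients `a τ` come from functions on `D ^ (m + 1)` such that two words which differ by
an interchange of neighbouring letters `p` and `q` have equal restrictions to
`D ^ (m + 1) {(p, q)}`. -/
def Compatible {m : ℕ} (a : Equiv.Perm (Fin (m + 1)) → (Fin (m + 1) → Bool) → A) : Prop :=
  ∀ τ (i : Fin m) s, ¬(s (τ i.castSucc) = true ∧ s (τ i.succ) = true) →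
    a τ s = a (τ * Equiv.swap i.castSucc i.succ) s

/-- The coefficients `a` and `b` come from functions on `D ^ n` with equal restrictions to
`D ^ n {(i, j) | i < j}`. -/
def AgreeOnStar {n : ℕ} (i : Fin n) (a b : (Fin n → Bool) → A) : Prop :=
  ∀ s, (∀ j, i < j → ¬(s i = true ∧ s j = true)) → a s = b s

namespace AgreeOnStar

lemma trans {n : ℕ} {i : Fin n} {a b c : (Fin n → Bool) → A} (hab : AgreeOnStar i a b)
    (hbc : AgreeOnStar i b c) : AgreeOnStar i a c := fun s hs => (hab s hs).trans (hbc s hs)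

lemma eq {n : ℕ} {a b : (Fin (n + 2) → Bool) → A}
    (h : AgreeOnStar (Fin.last n).castSucc a b) (s : Fin (n + 2) → Bool)
    (hs : ¬(s (Fin.last n).castSucc = true ∧ s (Fin.last (n + 1)) = true)) : a s = b s :=
  h s fun j hj => by rwa [Fin.last_le_iff.1 (Fin.castSucc_lt_iff_succ_le.1 hj)]

lemma sdCoeff [Sub A] {n : ℕ} {i : Fin n} {a a' b b' : (Fin (n + 2) → Bool) → A}
    (ha : AgreeOnStar i.castSucc.castSucc a a') (hb : AgreeOnStar i.castSucc.castSucc b b') :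
    AgreeOnStar i.castSucc (sdCoeff a b) (sdCoeff a' b') := by
  intro t ht
  have hstar {c : Bool} (hc : c = true → t i.castSucc = false) (j : Fin (n + 2))
      (hj : i.castSucc.castSucc < j) :
      ¬(snoc t c i.castSucc.castSucc = true ∧ snoc t c j = true) := by
    induction j using Fin.lastCases with
    | last => simpa only [Fin.snoc_castSucc, Fin.snoc_last] using by grind
    | cast j => simpa only [Fin.snoc_castSucc] using ht j hj
  unfold SDG.sdCoeff
  split_ifs with h
  · have hi : t i.castSucc = false := by simpa [h] using ht _ (Fin.castSucc_lt_last i)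
    rw [ha _ (hstar fun _ => hi), hb _ (hstar fun _ => hi)]
  · exact hb _ (hstar (by simp))

end AgreeOnStar

namespace Compatible

variable {m : ℕ} {a : Equiv.Perm (Fin (m + 1)) → (Fin (m + 1) → Bool) → A}

lemma translate (ha : Compatible a) (τ : Equiv.Perm (Fin (m + 1))) :
    Compatible fun π s => a (τ * π) (s ∘ ⇑τ⁻¹) := by
  intro π i s hs
  simpa only [← mul_assoc] using ha (τ * π) i (s ∘ ⇑τ⁻¹) (by simpa using hs)

lemma apply_false (ha : Compatible a) (τ : Equiv.Perm (Fin (m + 1))) :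
    a τ (fun _ => false) = a 1 fun _ => false :=
  eq_of_eqvGen_neighbours (J := wordShape m) (f := fun τ => a τ fun _ => false)
    (fun i => ha i.1 i.2 _ (by simp)) (eqvGen_neighbours_wordShape τ)

lemma agreeOnStar_swap (ha : Compatible a) {τ : Equiv.Perm (Fin (m + 1))} {i : Fin m}
    (hi : τ i.castSucc < τ i.succ) :
    AgreeOnStar (τ i.castSucc) (a τ) (a (τ * Equiv.swap i.castSucc i.succ)) :=
  fun s hs => ha τ i s (hs _ hi)

end Compatible

end Words

section FourLetters

lemma word_eq_one : word ![0, 1, 2, 3] = 1 := by ext i; fin_cases i <;> rfl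

lemma sign_word {w : Fin 4 → Fin 4} (hw : Function.Bijective w) {ε : ℤˣ}
    (hε : (∏ j : Fin 4, ∏ i ∈ Finset.Iio j, if w i < w j then 1 else -1) = ε := by decide) :
    Equiv.Perm.sign (word w hw) = ε :=
  (Equiv.Perm.sign_eq_prod_prod_Iio _).trans hε

variable {A : Type*}

/-- The alternating sum over the words occurring in the term of the Jacobi identity which starts
with the word `1234`. -/
noncomputable def bracket [AddGroup A] (a : Equiv.Perm (Fin 4) → A) : A :=
  a 1 - a (word ![0, 1, 3, 2]) - (a (word ![0, 2, 3, 1]) - a (word ![0, 3, 2, 1])) -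
    (a (word ![1, 2, 3, 0]) - a (word ![1, 3, 2, 0]) -
      (a (word ![2, 3, 1, 0]) - a (word ![3, 2, 1, 0])))

lemma sum_even_mul [AddCommMonoid A] {n : ℕ} (a : Equiv.Perm (Fin n) → A)
    (π : Equiv.Perm (Fin n)) :
    ∑ τ with Equiv.Perm.sign τ = 1, a (τ * π) =
      ∑ τ with Equiv.Perm.sign τ = Equiv.Perm.sign π, a τ := by
  refine Finset.sum_equiv (Equiv.mulRight π) (fun τ => ?_) fun τ _ => rfl
  simp

theorem sum_even_bracket [AddCommGroup A] (a : Equiv.Perm (Fin 4) → A) :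
    ∑ τ with Equiv.Perm.sign τ = 1, bracket (fun π => a (τ * π)) = 0 := by
  simp only [bracket, Finset.sum_sub_distrib, sum_even_mul, map_one,
    sign_word (w := ![0, 1, 3, 2]) _ (ε := -1), sign_word (w := ![0, 2, 3, 1]) _ (ε := 1),
    sign_word (w := ![0, 3, 2, 1]) _ (ε := -1), sign_word (w := ![1, 2, 3, 0]) _ (ε := -1),
    sign_word (w := ![1, 3, 2, 0]) _ (ε := 1), sign_word (w := ![2, 3, 1, 0]) _ (ε := -1),
    sign_word (w := ![3, 2, 1, 0]) _ (ε := 1)]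
  abel

lemma list_sum_bracket [AddCommGroup A] (a : Equiv.Perm (Fin 4) → A)
    {l : List (Equiv.Perm (Fin 4))} (hl : l.Nodup)
    (hl_even : ∀ τ, τ ∈ l ↔ Equiv.Perm.sign τ = 1) :
    (l.map fun τ => bracket fun π => a (τ * π)).sum = 0 := by
  rw [← List.sum_toFinset _ hl, ← sum_even_bracket a]
  congr 1
  ext τ
  simp [hl_even]

/-- The coefficients of the term of the Jacobi identity which starts with the word `1234`, formed
from the coefficients `a τ` of the cubes. -/
noncomputable def jacobiCoeff [Sub A] (a : Equiv.Perm (Fin 4) → (Fin 4 → Bool) → A) :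
    (Fin 1 → Bool) → A :=
  sdCoeff
    (sdCoeff (sdCoeff (a 1) (a (word ![0, 1, 3, 2])))
      (sdCoeff (a (word ![0, 2, 3, 1])) (a (word ![0, 3, 2, 1]))))
    (sdCoeff (sdCoeff (a (word ![1, 2, 3, 0])) (a (word ![1, 3, 2, 0])))
      (sdCoeff (a (word ![2, 3, 1, 0])) (a (word ![3, 2, 1, 0]))))

namespace Compatible

variable {a : Equiv.Perm (Fin 4) → (Fin 4 → Bool) → A}

lemma agreeOnStar_word (ha : Compatible a) (i : Fin 3) {p : Fin 4} {w w' : Fin 4 → Fin 4}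
    {hw : Function.Bijective w} (hw' : Function.Bijective w' := by decide)
    (hp : w i.castSucc = p := by decide) (hi : p < w i.succ := by decide)
    (hww' : ∀ j, w (Equiv.swap i.castSucc i.succ j) = w' j := by decide) :
    AgreeOnStar p (a (word w hw)) (a (word w' hw')) := by
  subst hp
  have hword : word w' hw' = word w hw * Equiv.swap i.castSucc i.succ :=
    Equiv.ext fun j => (hww' j).symm
  rw [hword]
  exact ha.agreeOnStar_swap (τ := word w hw) hi

lemma agreeOnStar_two (ha : Compatible a) :
    AgreeOnStar 2 (a 1) (a (word ![0, 1, 3, 2])) ∧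
      AgreeOnStar 2 (a (word ![0, 2, 3, 1])) (a (word ![0, 3, 2, 1])) ∧
      AgreeOnStar 2 (a (word ![1, 2, 3, 0])) (a (word ![1, 3, 2, 0])) ∧
      AgreeOnStar 2 (a (word ![2, 3, 1, 0])) (a (word ![3, 2, 1, 0])) := by
  rw [← word_eq_one]
  exact ⟨ha.agreeOnStar_word 2, ha.agreeOnStar_word 1, ha.agreeOnStar_word 1,
    ha.agreeOnStar_word 0⟩

lemma agreeOnStar_one (ha : Compatible a) :
    AgreeOnStar 1 (a 1) (a (word ![0, 2, 3, 1])) ∧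
      AgreeOnStar 1 (a (word ![0, 1, 3, 2])) (a (word ![0, 3, 2, 1])) ∧
      AgreeOnStar 1 (a (word ![1, 2, 3, 0])) (a (word ![2, 3, 1, 0])) ∧
      AgreeOnStar 1 (a (word ![1, 3, 2, 0])) (a (word ![3, 2, 1, 0])) := by
  rw [← word_eq_one]
  exact ⟨(ha.agreeOnStar_word 1 (w' := ![0, 2, 1, 3])).trans (ha.agreeOnStar_word 2),
    (ha.agreeOnStar_word 1 (w' := ![0, 3, 1, 2])).trans (ha.agreeOnStar_word 2),
    (ha.agreeOnStar_word 0 (w' := ![2, 1, 3, 0])).trans (ha.agreeOnStar_word 1),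
    (ha.agreeOnStar_word 0 (w' := ![3, 1, 2, 0])).trans (ha.agreeOnStar_word 1)⟩

lemma agreeOnStar_zero (ha : Compatible a) :
    AgreeOnStar 0 (a 1) (a (word ![1, 2, 3, 0])) ∧
      AgreeOnStar 0 (a (word ![0, 1, 3, 2])) (a (word ![1, 3, 2, 0])) ∧
      AgreeOnStar 0 (a (word ![0, 2, 3, 1])) (a (word ![2, 3, 1, 0])) ∧
      AgreeOnStar 0 (a (word ![0, 3, 2, 1])) (a (word ![3, 2, 1, 0])) := by
  rw [← word_eq_one]
  exact ⟨((ha.agreeOnStar_word 0 (w' := ![1, 0, 2, 3])).trans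
      (ha.agreeOnStar_word 1 (w' := ![1, 2, 0, 3]))).trans (ha.agreeOnStar_word 2),
    ((ha.agreeOnStar_word 0 (w' := ![1, 0, 3, 2])).trans
      (ha.agreeOnStar_word 1 (w' := ![1, 3, 0, 2]))).trans (ha.agreeOnStar_word 2),
    ((ha.agreeOnStar_word 0 (w' := ![2, 0, 3, 1])).trans
      (ha.agreeOnStar_word 1 (w' := ![2, 3, 0, 1]))).trans (ha.agreeOnStar_word 2),
    ((ha.agreeOnStar_word 0 (w' := ![3, 0, 2, 1])).trans
      (ha.agreeOnStar_word 1 (w' := ![3, 2, 0, 1]))).trans (ha.agreeOnStar_word 2)⟩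

lemma jacobiCoeff_eq [AddGroup A] (ha : Compatible a) :
    jacobiCoeff a =
      tangentCoeff (a 1 fun _ => false) (bracket fun π => a π fun _ => true) := by
  have hsnoc {n : ℕ} (b : Bool) : snoc (fun _ : Fin n => b) b = fun _ => b :=
    funext fun i => by cases i using Fin.lastCases <;> simp
  rw [eq_tangentCoeff (jacobiCoeff a)]
  simp only [jacobiCoeff, sdCoeff, hsnoc, bracket, if_true, Bool.false_eq_true, if_false,
    ha.apply_false (word _ _)]

end Compatible

end FourLetters

section Represents

variable {C : Type u} [Category.{v} C] [CartesianMonoidalCategory C] [BraidedCategory C]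
  [HasFiniteLimits C] {k : Type w} [CommRing k] {R : C} [CommRingObj R] [AlgebraObj k R]

lemma atZero_expand {n : ℕ} {X : C} (a : (Fin n → Bool) → (X ⟶ R)) :
    atZero (expand ∅ a) = a fun _ => false := by
  rw [atZero, expand, comp_sum, Finset.sum_eq_single (fun _ => false) _ (by simp)]
  · rw [MonObj.comp_mul, lift_snd_assoc, Category.id_comp, ← compHom_apply _ (mon _ _), map_mon]
    simp [mon]
  · intro s _ hs
    obtain ⟨i, hi⟩ : ∃ i, s i = true := by simpa using Function.ne_iff.1 hs
    have hmon : mon (fun i => compHom (lift (mk (fun _ => 0) (by simp) (by simp)) (𝟙 X))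
        (fst (D R n ∅) X ≫ coord i)) s = 0 :=
      Finset.prod_eq_zero (Finset.mem_univ i) (by simp [hi, compHom_apply])
    rw [MonObj.comp_mul, ← compHom_apply _ (mon _ _), map_mon, hmon, mul_zero]

lemma tangentZero_eq_expand {X : C} (r : X ⟶ R) :
    tangentZero R r = expand ∅ (tangentCoeff r 0) := by
  rw [expand, sum_fin_one]
  simp [tangentZero, tangentCoeff, mon, AddMonObj.comp_zero]

variable {W : Type w} [CommRing W] [Algebra k W] {G X M : C} {n : ℕ}

/-- The expression `E` is defined, and its value is the image under `g` of a mapping into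
`G = Spec_R W` on which each `f : W` takes the value with coefficients `a s f`. -/
def Represents (x : W →ₐ[k] (G ⟶ R)) (g : G ⊗ X ⟶ M) (E : Part (Cube R X M n))
    (a : (Fin n → Bool) → W → (X ⟶ R)) : Prop :=
  ∃ δ : Cube R X G n, E = Part.some (push g δ) ∧ ∀ f, δ ≫ x f = expand ∅ fun s => a s f

lemma exists_compatible_represents (hR : KockLawvere k R) {m : ℕ} (x : W →ₐ[k] (G ⟶ R))
    (g : G ⊗ X ⟶ M) {ι : Equiv.Perm (Fin (m + 1)) → (D R (m + 1) ∅ ⟶ G)}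
    (hι : ∀ i : (wordShape m).L, incl (wordRel i) ≫ ι ((wordShape m).fst i) =
      incl (wordRel i) ≫ ι ((wordShape m).snd i)) :
    ∃ a : Equiv.Perm (Fin (m + 1)) → (Fin (m + 1) → Bool) → W → (X ⟶ R), Compatible a ∧
      ∀ τ, Represents x g (Part.some (ι τ ▷ X ≫ g)) (a τ) := by
  choose a ha using fun τ f => exists_expand hR (fst _ X ≫ ι τ ≫ x f)
  refine ⟨fun τ s f => a τ f s, fun τ i s hs => funext fun f => ?_,
    fun τ => ⟨fst _ X ≫ ι τ, ?_, fun f => by rw [Category.assoc, ha]⟩⟩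
  · have hne : τ i.castSucc ≠ τ i.succ := τ.injective.ne Fin.castSucc_lt_succ.ne
    refine (incl_expand_eq_iff hR hne).1 ?_ s hs
    rw [ha, ha, whiskerRight_fst_assoc, whiskerRight_fst_assoc]
    simpa only [Category.assoc, wordRel] using congrArg (fst _ X ≫ · ≫ x f) (hι (τ, i))
  · congr 1
    rw [push]
    congr 1
    ext <;> simp

namespace Represents

variable {x : W →ₐ[k] (G ⟶ R)} {g : G ⊗ X ⟶ M}

lemma unique (hx : IsSpec k R x) {E F : Part (Cube R X M n)}
    {a : (Fin n → Bool) → W → (X ⟶ R)} (hE : Represents x g E a) (hF : Represents x g F a) :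
    E = F := by
  obtain ⟨δ, rfl, hδ⟩ := hE
  obtain ⟨δ', rfl, hδ'⟩ := hF
  rw [hx.hom_ext fun f => (hδ f).trans (hδ' f).symm]

lemma permute {γ : Cube R X M n} {a : (Fin n → Bool) → W → (X ⟶ R)}
    (hγ : Represents x g (Part.some γ) a) (σ : Equiv.Perm (Fin n)) :
    Represents x g (Part.some (permute σ ▷ X ≫ γ)) fun s => a (s ∘ ⇑σ⁻¹) := by
  obtain ⟨δ, hδ, hδa⟩ := hγ
  obtain rfl := Part.some_injective hδ
  exact ⟨SDG.permute σ ▷ X ≫ δ, by rw [whiskerRight_push], fun f => by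
    rw [Category.assoc, hδa, permute_expand]⟩

lemma tangentZero {γ : Cube R X M n} {a : (Fin n → Bool) → W → (X ⟶ R)}
    (hγ : Represents x g (Part.some γ) a) :
    Represents x g (Part.some (tangentZero R (atZero γ))) (tangentCoeff (a fun _ => false) 0) := by
  obtain ⟨δ, hδ, hδa⟩ := hγ
  obtain rfl := Part.some_injective hδ
  refine ⟨SDG.tangentZero R (atZero δ), ?_, fun f => ?_⟩
  · simp [SDG.tangentZero, push, atZero, comp_lift_assoc]
  · have hf : SDG.tangentZero R (atZero δ) ≫ x f = SDG.tangentZero R (atZero (δ ≫ x f)) := by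
      simp only [SDG.tangentZero, atZero, Category.assoc]
    rw [hf, hδa, atZero_expand, tangentZero_eq_expand]
    congr 1
    ext t
    cases ht : t 0 <;> simp [tangentCoeff, ht]

variable [MonoidalClosed C]

theorem strongDiffPart (hR : KockLawvere k R) (hM : Microlinear k R M) (hx : IsSpec k R x)
    {E F : Part (Cube R X M (n + 2))} {a b : (Fin (n + 2) → Bool) → W → (X ⟶ R)}
    (hE : Represents x g E a) (hF : Represents x g F b)
    (hab : AgreeOnStar (Fin.last n).castSucc a b) :
    Represents x g (strongDiffPart E F) (sdCoeff a b) := by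
  obtain ⟨δ₁, rfl, h₁⟩ := hE
  obtain ⟨δ₂, rfl, h₂⟩ := hF
  choose ν hν₁ hν₂ hν using fun f => exists_strongDiff fun s hs => congrFun (hab.eq s hs) f
  obtain ⟨δ, hδ, hδν⟩ := (isQuasiPushout_strongDiff hR n).interpolate_push hM hx (e n) g ν
    (fun f => (hν₁ f).trans (h₁ f).symm) fun f => (hν₂ f).trans (h₂ f).symm
  refine ⟨δ, ?_, fun f => ?_⟩
  · rw [SDG.strongDiffPart, Part.bind_some, Part.bind_some]
    exact hδ
  · rw [hδν, hν]
    congr 1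
    ext t
    unfold sdCoeff
    split_ifs <;> rfl

theorem tangentAdd (hR : KockLawvere k R) (hM : Microlinear k R M) (hx : IsSpec k R x)
    {E F : Part (Cube R X M 1)} {c v₁ v₂ : W → (X ⟶ R)}
    (hE : Represents x g E (tangentCoeff c v₁)) (hF : Represents x g F (tangentCoeff c v₂)) :
    Represents x g (E.bind fun t₁ => F.bind fun t₂ => tangentAdd t₁ t₂)
      (tangentCoeff c (v₁ + v₂)) := by
  have happly (v : W → (X ⟶ R)) (f : W) :
      (fun s => tangentCoeff c v s f) = tangentCoeff (c f) (v f) := by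
    ext s
    unfold tangentCoeff
    split_ifs <;> rfl
  simp only [Represents, happly] at hE hF ⊢
  obtain ⟨δ₁, rfl, h₁⟩ := hE
  obtain ⟨δ₂, rfl, h₂⟩ := hF
  simp only [Part.bind_some]
  choose ν hν₁ hν₂ hν using fun f => exists_tangentAdd (c f) (v₁ f) (v₂ f)
  obtain ⟨δ, hδ, hδν⟩ := (isQuasiPushout_tangentAdd hR).interpolate_push hM hx diag g ν
    (fun f => (hν₁ f).trans (h₁ f).symm) fun f => (hν₂ f).trans (h₂ f).symm
  exact ⟨δ, hδ, fun f => (hδν f).trans (hν f)⟩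

theorem tangentSum (hR : KockLawvere k R) (hM : Microlinear k R M) (hx : IsSpec k R x)
    {I : Type*} {E : I → Part (Cube R X M 1)} {c : W → (X ⟶ R)} {v : I → W → (X ⟶ R)} {y : X ⟶ M}
    (hy : Represents x g (Part.some (SDG.tangentZero R y)) (tangentCoeff c 0))
    (hE : ∀ i, Represents x g (E i) (tangentCoeff c (v i))) (l : List I) :
    Represents x g (tangentSum y (l.map E)) (tangentCoeff c (l.map v).sum) := by
  induction l with
  | nil => exact hy
  | cons i l ih =>
    rw [List.map_cons, List.map_cons, List.sum_cons]
    exact tangentAdd hR hM hx (hE i) ih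

theorem nestedStrongDiff (hR : KockLawvere k R) (hM : Microlinear k R M) (hx : IsSpec k R x)
    {E : Equiv.Perm (Fin 4) → Part (Cube R X M 4)}
    {a : Equiv.Perm (Fin 4) → (Fin 4 → Bool) → W → (X ⟶ R)} (ha : Compatible a)
    (hE : ∀ π, Represents x g (E π) (a π)) :
    Represents x g
      (SDG.strongDiffPart
        (SDG.strongDiffPart (SDG.strongDiffPart (E 1) (E (word ![0, 1, 3, 2])))
          (SDG.strongDiffPart (E (word ![0, 2, 3, 1])) (E (word ![0, 3, 2, 1]))))
        (SDG.strongDiffPart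
          (SDG.strongDiffPart (E (word ![1, 2, 3, 0])) (E (word ![1, 3, 2, 0])))
          (SDG.strongDiffPart (E (word ![2, 3, 1, 0])) (E (word ![3, 2, 1, 0])))))
      (jacobiCoeff a) := by
  obtain ⟨h₂₁, h₂₂, h₂₃, h₂₄⟩ := ha.agreeOnStar_two
  obtain ⟨h₁₁, h₁₂, h₁₃, h₁₄⟩ := ha.agreeOnStar_one
  obtain ⟨h₀₁, h₀₂, h₀₃, h₀₄⟩ := ha.agreeOnStar_zero
  have hsd (π ρ) (h : AgreeOnStar 2 (a π) (a ρ)) := (hE π).strongDiffPart hR hM hx (hE ρ) h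
  exact strongDiffPart hR hM hx
    (strongDiffPart hR hM hx (hsd _ _ h₂₁) (hsd _ _ h₂₂) (.sdCoeff (i := 1) h₁₁ h₁₂))
    (strongDiffPart hR hM hx (hsd _ _ h₂₃) (hsd _ _ h₂₄) (.sdCoeff (i := 1) h₁₃ h₁₄))
    (.sdCoeff (i := 0) (.sdCoeff (i := 0) h₀₁ h₀₂) (.sdCoeff (i := 0) h₀₃ h₀₄))

theorem jacobiTerm (hR : KockLawvere k R) (hM : Microlinear k R M) (hx : IsSpec k R x)
    {γ : Equiv.Perm (Fin 4) → Cube R X M 4}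
    {a : Equiv.Perm (Fin 4) → (Fin 4 → Bool) → W → (X ⟶ R)} (ha : Compatible a)
    (hγ : ∀ τ, Represents x g (Part.some (γ τ)) (a τ)) (τ : Equiv.Perm (Fin 4)) :
    Represents x g (jacobiTerm γ τ)
      (tangentCoeff (a 1 fun _ => false) (bracket fun π => a (τ * π) fun _ => true)) := by
  have haτ := ha.translate τ
  have hnested := nestedStrongDiff hR hM hx haτ fun π => (hγ (τ * π)).permute τ
  rw [haτ.jacobiCoeff_eq] at hnested
  simpa only [SDG.jacobiTerm, strongDiffPerm, SDG.strongDiffPart, Part.bind_some, mul_one,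
    Function.comp_def, ha.apply_false τ] using hnested

end Represents

end Represents

end SDG

theorem theorem3p2 {C : Type u} [Category.{v} C] [CartesianMonoidalCategory C] [BraidedCategory C]
    [MonoidalClosed C] [HasFiniteLimits C]
    (k : Type w) [CommRing k] (R : C) [CommRingObj R] [SDG.AlgebraObj k R]
    (hR : SDG.KockLawvere k R) (M : C) (hM : SDG.Microlinear k R M) (X : C)
    (γ : Equiv.Perm (Fin 4) → SDG.Cube R X M 4)
    (hγ : ∀ (τ : Equiv.Perm (Fin 4)) (i : Fin 3),
      SDG.AgreeOn {(τ i.castSucc, τ i.succ)} (γ τ) (γ (τ * Equiv.swap i.castSucc i.succ)))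
    (l : List (Equiv.Perm (Fin 4))) (hl : l.Nodup)
    (hl_even : ∀ τ, τ ∈ l ↔ Equiv.Perm.sign τ = 1) :
    SDG.tangentSum (SDG.atZero (γ 1)) (l.map (SDG.jacobiTerm γ)) =
      Part.some (SDG.tangentZero R (SDG.atZero (γ 1))) := by
  obtain ⟨G, x, ι, hx, hι, hglue⟩ :=
    SDG.exists_universal_gluing hR SDG.eqvGen_neighbours_wordShape hM SDG.wordRel
  obtain ⟨g, hg⟩ := hglue X γ fun i => hγ i.1 i.2
  obtain ⟨a, ha, hrep⟩ :=
    SDG.exists_compatible_represents hR (W := SDG.GluedAlg k SDG.wordRel) x g hι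
  simp only [hg] at hrep
  have hzero := (hrep 1).tangentZero
  have hsum := SDG.Represents.tangentSum hR hM hx hzero
    (SDG.Represents.jacobiTerm hR hM hx ha hrep) l
  rw [SDG.list_sum_bracket (fun π => a π fun _ => true) hl hl_even] at hsum
  exact hsum.unique hx hzero
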